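/- Let $\{\varphi_n\}$ ($n\in\mathbb N$ or $n\in\mathbb Z$) be an orthonormal system in the complex space $L_2=L_2(0,1)$ with $M:=\sup_n\|\varphi_n\|_{L_\infty}<\infty$, and let $\mathcal F^{-1}$ be the map $\{c_n\}\mapsto\sum_n c_n\varphi_n$, the series converging in $L_2$. Write $f^*$ for the non-increasing rearrangement of $|f|$ on $[0,1]$ and $c_1^*\ge c_2^*\ge\dots$ for the non-increasing rearrangement of $\{|c_n|\}$. For $0<q\le\infty$ and $\alpha\in\mathbb R$ (with $1/\infty=0$) put $$\|c\|_{l_{2,q}(\log l)_\alpha}=\big\|k^{\frac12-\frac1q}(1+\log k)^\alpha c_k^*\big\|_{l_q(\mathbb{N})},\qquad \|f\|_{L_{2,q}(\log L)_\alpha}=\big\|t^{\frac12-\frac1q}(1+|\log t|)^\alpha f^*(t)\big\|_{L_q(0,1)},$$ $$\|f\|_{L^{\mathcal L}_{2,q,\alpha,2}}=\Big\|t^{-\frac1q}(1+|\log t|)^\alpha\Big(\int_0^t f^*(u)^2\,du\Big)^{1/2}\Big\|_{L_q(0,1)},$$ let each space consist of the elements with finite (quasi-)norm, and give an intersection of two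 spaces the maximum of the two (quasi-)norms. **Corollary 4.4.** Let $1<q\le\infty$ and $\max(-1/q,\,1/q-1)<\alpha<1-1/q$. Then for every sufficiently small $\varepsilon>0$ (depending only on $q,\alpha$) there is a constant $C$ depending only on $q,\alpha,\varepsilon$ such that, for every such system, the series $\sum_n c_n\varphi_n$ converges in $L_2$ for each $c\in l_{2,q}(\log l)_{\alpha+1/\min(q,2)}$, and $$\big\|\mathcal F^{-1}\,\big|\,l_{2,q}(\log l)_{\alpha+1/\min(q,2)}\to L^{\mathcal L}_{2,q,\alpha,2}\big\|\le C\,(1+\log M)^{|\alpha+\varepsilon+1/q|},$$ $$\big\|\mathcal F^{-1}\,\big|\,l_{2,q}(\log l)_{\alpha+1/\min(q,2)}\to L_{2,q}(\log L)_{\alpha+1/\max(q,2)}\cap L_{2,\max(q,2)}(\log L)_{\alpha+1/q}\big\|\le C\,(1+\log M)^{|\alpha+\varepsilon+1/q|}.$$ -/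

import Mathlib

open MeasureTheory Set
open scoped ENNReal NNReal

noncomputable section

namespace LorentzZygmund

/-- The real number `1 / q` for `0 < q ≤ ∞`, with `1 / ∞ = 0`. -/
def recip (q : ℝ≥0∞) : ℝ := (q⁻¹).toReal

/-- Lebesgue measure on `[0, 1]`. -/
def μ01 : Measure ℝ := volume.restrict (Icc 0 1)

/-- The non-increasing rearrangement
`f^*(t) = inf {s ≥ 0 : |{x ∈ [0,1] : |f x| > s}| ≤ t}` of a function `f` on `[0, 1]`. -/
def rearr (f : ℝ → ℂ) (t : ℝ) : ℝ≥0∞ :=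
  sInf {s : ℝ≥0∞ | μ01 {x | s < ‖f x‖ₑ} ≤ ENNReal.ofReal t}

/-- The non-increasing rearrangement of a family of complex numbers:
`seqRearr c j` is `c^*_{j+1} = inf {s ≥ 0 : #{n : |c n| > s} ≤ j}`, so that `seqRearr c 0` is the
supremum of the numbers `|c n|`. -/
def seqRearr {ι : Type} (c : ι → ℂ) (j : ℕ) : ℝ≥0∞ :=
  sInf {s : ℝ≥0∞ | {n | s < ‖c n‖ₑ}.encard ≤ (j : ℕ∞)}

/-- The (quasi-)norm of the Lorentz–Zygmund function space `L_{p,q}(log L)_α`: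
`‖ t^{1/p-1/q} (1+|log t|)^α f^*(t) | L_q(0,1) ‖`. The space is the set where it is finite. -/
def lzNorm (p q : ℝ≥0∞) (α : ℝ) (f : ℝ → ℂ) : ℝ≥0∞ :=
  eLpNorm (fun t : ℝ =>
      ENNReal.ofReal (t ^ (recip p - recip q) * (1 + |Real.log t|) ^ α) * rearr f t)
    q (volume.restrict (Ioo 0 1))

/-- The (quasi-)norm of the Lorentz–Zygmund sequence space `l_{p,q}(log l)_α`:
`‖ k^{1/p-1/q} (1+log k)^α c^*_k | l_q ‖`, where `k = j + 1` runs over the positive integers.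
The space is the set where it is finite. -/
def lzSeqNorm {ι : Type} (p q : ℝ≥0∞) (α : ℝ) (c : ι → ℂ) : ℝ≥0∞ :=
  eLpNorm (fun j : ℕ =>
      ENNReal.ofReal (((j : ℝ) + 1) ^ (recip p - recip q) * (1 + Real.log ((j : ℝ) + 1)) ^ α)
        * seqRearr c j)
    q Measure.count

/-- The (quasi-)norm of the limiting space `L^𝓛_{p,q,α,r}`:
`‖ t^{-1/q} (1+|log t|)^α ‖ u^{1/p-1/r} f^*(u) | L_r(0,t) ‖ | L_q(0,1) ‖`.
The space is the set where it is finite. -/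
def limNorm (p q : ℝ≥0∞) (α : ℝ) (r : ℝ≥0∞) (f : ℝ → ℂ) : ℝ≥0∞ :=
  eLpNorm (fun t : ℝ =>
      ENNReal.ofReal (t ^ (-recip q) * (1 + |Real.log t|) ^ α) *
        eLpNorm (fun u : ℝ => ENNReal.ofReal (u ^ (recip p - recip r)) * rearr f u)
          r (volume.restrict (Ioo 0 t)))
    q (volume.restrict (Ioo 0 1))

end LorentzZygmund

end

/-
Write `f = ∑ c_n φ_n = g + h`, where `g` collects the at most `2K` coefficients with
`|c_n| > c^*_{2K+1}`. Then `‖g‖_∞ ≤ M √(2K) ‖c‖₂` and `‖h‖₂² ≤ 2 ∑_{k>K} (c_k^*)²`, so that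
`(∫_0^t f^*²)^{1/2} ≤ M √(2K) ‖c‖₂ √t + 2 (∑_{k>K} (c_k^*)²)^{1/2}`.
Cut `(0, 1)` and `ℕ` into the blocks on which the logarithmic weight lies in `[2^n, 2^{n+1})`
and take `t = exp(1 - 2^{n+2})`, `K = ⌈exp(2^n - 1)⌉`. As soon as `2^n ≥ 1 + log M`, the first
term is `O(exp(-2^n / 2) ‖c‖₂)`. On the remaining blocks, about `log₂(1 + log M)` in number, the
trivial bound by `‖c‖₂` costs the factor `(1 + log M)^{α + 1/q}`. All the norms in question are
equivalent to, or bounded by, `l_q`-norms of block norms with the weights `2^{n(α + 1/q)}`, and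
since `α + 1/q > 0`, Hardy's inequality passes from the blocks of `c^*` to its tails.
-/

noncomputable section

namespace LorentzZygmund

section LpNorms

variable {X Y : Type*} [MeasurableSpace X] [MeasurableSpace Y] {μ : Measure X} {ν : Measure Y}
  {p : ℝ≥0∞}

theorem lintegral_eq_lintegral_measure_ofReal_lt {f : X → ℝ≥0∞} (hf : AEMeasurable f μ) :
    ∫⁻ x, f x ∂μ = ∫⁻ s in Ioi (0 : ℝ), μ {x | ENNReal.ofReal s < f x} := by
  by_cases hfin : ∀ᵐ x ∂μ, f x ≠ ∞
  · have hreal : ∫⁻ x, f x ∂μ = ∫⁻ x, ENNReal.ofReal (f x).toReal ∂μ := by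
      refine lintegral_congr_ae ?_
      filter_upwards [hfin] with x hx using (ENNReal.ofReal_toReal hx).symm
    rw [hreal, lintegral_eq_lintegral_meas_lt μ (.of_forall fun _ => ENNReal.toReal_nonneg)
      hf.ennreal_toReal]
    refine setLIntegral_congr_fun measurableSet_Ioi fun s hs => measure_congr ?_
    filter_upwards [hfin] with x hx
    exact propext (ENNReal.ofReal_lt_iff_lt_toReal (le_of_lt hs) hx).symm
  · have htop : μ {x | f x = ∞} ≠ 0 := by
      simpa only [ae_iff, ne_eq, not_not] using hfin
    have hint : ∫⁻ x, f x ∂μ = ∞ := by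
      by_contra h
      exact htop (measure_eq_top_of_lintegral_ne_top hf h)
    refine hint.trans (top_le_iff.1 ?_).symm
    calc ∞ = ∫⁻ _ in Ioi (0 : ℝ), μ {x | f x = ∞} := by simp [ENNReal.mul_top htop]
      _ ≤ ∫⁻ s in Ioi (0 : ℝ), μ {x | ENNReal.ofReal s < f x} :=
          lintegral_mono fun s => measure_mono fun x (hx : f x = ∞) =>
            ENNReal.ofReal_lt_top.trans_eq hx.symm

theorem eLpNorm_le_of_measure_lt_le {f : X → ℝ≥0∞} {g : Y → ℝ≥0∞} (hf : AEMeasurable f μ)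
    (hg : AEMeasurable g ν) (hp : p ≠ ∞) (hfg : ∀ s, μ {x | s < f x} ≤ ν {y | s < g y}) :
    eLpNorm f p μ ≤ eLpNorm g p ν := by
  rcases eq_or_ne p 0 with rfl | hp₀
  · simp
  have hp_pos : 0 < p.toReal := ENNReal.toReal_pos hp₀ hp
  simp only [eLpNorm_eq_lintegral_rpow_enorm_toReal hp₀ hp, enorm_eq_self]
  gcongr ?_ ^ _
  rw [lintegral_eq_lintegral_measure_ofReal_lt (hf.pow_const _),
    lintegral_eq_lintegral_measure_ofReal_lt (hg.pow_const _)]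
  refine lintegral_mono fun s => ?_
  simpa only [one_div, ENNReal.rpow_inv_lt_iff hp_pos]
    using hfg (ENNReal.ofReal s ^ (1 / p.toReal))

theorem eLpNorm_sum_measure {ι : Type*} [Countable ι] [MeasurableSpace ι]
    [MeasurableSingletonClass ι] (μ : ι → Measure X) (f : X → ℝ≥0∞) (hp : p ≠ 0) :
    eLpNorm f p (Measure.sum μ) = eLpNorm (fun i => eLpNorm f p (μ i)) p Measure.count := by
  rcases eq_or_ne p ∞ with rfl | hp_top
  · simp only [eLpNorm_exponent_top, eLpNormEssSup_count, enorm_eq_self]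
    refine le_antisymm (essSup_le_of_ae_le _ ?_) (iSup_le fun i => eLpNormEssSup_mono_measure f
      (Measure.absolutelyContinuous_of_le (Measure.le_sum μ i)))
    refine Measure.ae_sum_iff.2 fun i => ?_
    filter_upwards [ae_le_eLpNormEssSup (f := f) (μ := μ i)] with x hx
    exact hx.trans (le_iSup (fun i => eLpNormEssSup f (μ i)) i)
  · have hp_pos : 0 < p.toReal := ENNReal.toReal_pos hp hp_top
    simp only [eLpNorm_eq_lintegral_rpow_enorm_toReal hp hp_top, enorm_eq_self,
      lintegral_sum_measure, lintegral_count, ← ENNReal.rpow_mul, one_div_mul_cancel hp_pos.ne',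
      ENNReal.rpow_one]

theorem eLpNorm_eq_eLpNorm_restrict_fiber {ι : Type*} [Countable ι] [MeasurableSpace ι]
    [MeasurableSingletonClass ι] (f : X → ℝ≥0∞) (hp : p ≠ 0) {l : X → ι} (hl : Measurable l) :
    eLpNorm f p μ =
      eLpNorm (fun i => eLpNorm f p (μ.restrict (l ⁻¹' {i}))) p Measure.count := by
  rw [← eLpNorm_sum_measure _ _ hp, ← Measure.restrict_iUnion
    (fun i j hij => Disjoint.preimage _ (by simpa using hij))
    (fun i => hl (measurableSet_singleton i)), ← preimage_iUnion, iUnion_of_singleton,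
    preimage_univ, Measure.restrict_univ]

theorem eLpNorm_iSup_of_monotone {f : ℕ → X → ℝ≥0∞} (hf : ∀ n, Measurable (f n))
    (hmono : Monotone f) (hp : p ≠ 0) :
    eLpNorm (fun x => ⨆ n, f n x) p μ = ⨆ n, eLpNorm (f n) p μ := by
  refine le_antisymm ?_ (iSup_le fun n => eLpNorm_mono_enorm fun x => le_iSup (fun n => f n x) n)
  rcases eq_or_ne p ∞ with rfl | hp_top
  · refine essSup_le_of_ae_le _ ?_
    filter_upwards [ae_all_iff.2 fun n => ae_le_eLpNormEssSup (f := f n) (μ := μ)] with x hx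
    exact iSup_mono hx
  · have hp_pos : 0 < p.toReal := ENNReal.toReal_pos hp hp_top
    simp only [eLpNorm_eq_lintegral_rpow_enorm_toReal hp hp_top, enorm_eq_self, one_div,
      ENNReal.rpow_inv_le_iff hp_pos]
    have hpow : ∀ x, (⨆ n, f n x) ^ p.toReal = ⨆ n, f n x ^ p.toReal := fun x =>
      (ENNReal.orderIsoRpow p.toReal hp_pos).map_iSup _
    simp only [hpow]
    rw [lintegral_iSup (fun n => (hf n).pow_const _)
      fun i j hij x => ENNReal.rpow_le_rpow (hmono hij x) hp_pos.le]
    refine iSup_le fun n => (ENNReal.rpow_inv_le_iff hp_pos).1 ?_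
    exact le_iSup (fun n => (∫⁻ x, f n x ^ p.toReal ∂μ) ^ p.toReal⁻¹) n

theorem eLpNorm_tsum_le {f : ℕ → X → ℝ≥0∞} (hf : ∀ i, Measurable (f i)) (hp : 1 ≤ p) :
    eLpNorm (fun x => ∑' i, f i x) p μ ≤ ∑' i, eLpNorm (f i) p μ := by
  simp only [ENNReal.tsum_eq_iSup_nat]
  rw [eLpNorm_iSup_of_monotone (fun N => Finset.measurable_sum _ fun i _ => hf i)
    (fun m n hmn x => Finset.sum_le_sum_of_subset (Finset.range_mono hmn))
    (zero_lt_one.trans_le hp).ne']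
  gcongr with N
  have hsum := eLpNorm_sum_le (μ := μ) (s := Finset.range N)
    (fun i _ => (hf i).aestronglyMeasurable) hp
  rwa [Finset.sum_fn] at hsum

theorem eLpNorm_le_of_exponent_le_of_bound {g : X → ℝ≥0∞} {r A : ℝ≥0∞} (hp : p ≠ 0) (hpr : p ≤ r)
    (hgA : ∀ᵐ x ∂μ, g x ≤ A) (hnorm : eLpNorm g p μ ≤ A) : eLpNorm g r μ ≤ A := by
  rcases eq_or_ne r ∞ with rfl | hr_top
  · exact essSup_le_of_ae_le _ hgA
  rcases eq_or_ne A ∞ with rfl | hA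
  · exact le_top
  have hp_top : p ≠ ∞ := ne_top_of_le_ne_top hr_top hpr
  have hr : r ≠ 0 := (hp.bot_lt.trans_le hpr).ne'
  have hp_pos : 0 < p.toReal := ENNReal.toReal_pos hp hp_top
  have hr_pos : 0 < r.toReal := ENNReal.toReal_pos hr hr_top
  have hpr_nonneg : 0 ≤ r.toReal - p.toReal := sub_nonneg.2 (ENNReal.toReal_mono hr_top hpr)
  have split_rpow (a : ℝ≥0∞) : a ^ r.toReal = a ^ (r.toReal - p.toReal) * a ^ p.toReal := by
    rw [← ENNReal.rpow_add_of_nonneg _ _ hpr_nonneg hp_pos.le, sub_add_cancel]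
  simp only [eLpNorm_eq_lintegral_rpow_enorm_toReal hp hp_top,
    eLpNorm_eq_lintegral_rpow_enorm_toReal hr hr_top, enorm_eq_self, one_div,
    ENNReal.rpow_inv_le_iff hp_pos, ENNReal.rpow_inv_le_iff hr_pos] at hnorm ⊢
  calc ∫⁻ x, g x ^ r.toReal ∂μ ≤ ∫⁻ x, A ^ (r.toReal - p.toReal) * g x ^ p.toReal ∂μ := by
        refine lintegral_mono_ae ?_
        filter_upwards [hgA] with x hx
        rw [split_rpow]
        gcongr
    _ = A ^ (r.toReal - p.toReal) * ∫⁻ x, g x ^ p.toReal ∂μ :=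
        lintegral_const_mul' _ _ (ENNReal.rpow_ne_top_of_nonneg hpr_nonneg hA)
    _ ≤ A ^ (r.toReal - p.toReal) * A ^ p.toReal := by gcongr
    _ = A ^ r.toReal := (split_rpow A).symm

theorem eLpNorm_count_anti {ι : Type*} [MeasurableSpace ι] [MeasurableSingletonClass ι]
    (y : ι → ℝ≥0∞) {r : ℝ≥0∞} (hp : p ≠ 0) (hpr : p ≤ r) :
    eLpNorm y r Measure.count ≤ eLpNorm y p Measure.count :=
  eLpNorm_le_of_exponent_le_of_bound hp hpr
    (.of_forall fun i => enorm_le_eLpNorm_count y i hp) le_rfl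

theorem eLpNorm_count_comp_le {ι κ : Type*} [MeasurableSpace ι] [MeasurableSingletonClass ι]
    [MeasurableSpace κ] [MeasurableSingletonClass κ] (y : κ → ℝ≥0∞) (hp : p ≠ 0) {e : ι → κ}
    (he : e.Injective) :
    eLpNorm (fun i => y (e i)) p Measure.count ≤ eLpNorm y p Measure.count := by
  rcases eq_or_ne p ∞ with rfl | hp_top
  · simp only [eLpNorm_exponent_top, eLpNormEssSup_count, enorm_eq_self]
    exact iSup_comp_le y e
  · simp only [eLpNorm_eq_lintegral_rpow_enorm_toReal hp hp_top, enorm_eq_self, lintegral_count]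
    gcongr
    exact ENNReal.tsum_comp_le_tsum_of_injective he fun n => y n ^ p.toReal

theorem eLpNorm_count_le_add_succ (y : ℕ → ℝ≥0∞) (hp : 1 ≤ p) :
    eLpNorm y p Measure.count ≤ y 0 + eLpNorm (fun n => y (n + 1)) p Measure.count := by
  have hp₀ : p ≠ 0 := (zero_lt_one.trans_le hp).ne'
  rcases eq_or_ne p ∞ with rfl | hp_top
  · simp only [eLpNorm_exponent_top, eLpNormEssSup_count, enorm_eq_self]
    exact (sup_iSup_nat_succ y).symm.trans_le
      (sup_le le_self_add ((iSup_le fun n => le_iSup (fun n => y (n + 1)) n).trans le_add_self))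
  · have hp_pos : 0 < p.toReal := ENNReal.toReal_pos hp₀ hp_top
    have h := ENNReal.rpow_add_rpow_le_add (y 0)
      ((∑' n, y (n + 1) ^ p.toReal) ^ (1 / p.toReal)) (by simpa using ENNReal.toReal_mono hp_top hp)
    rw [← ENNReal.rpow_mul (∑' n, y (n + 1) ^ p.toReal), one_div_mul_cancel hp_pos.ne',
      ENNReal.rpow_one] at h
    simp only [eLpNorm_eq_lintegral_rpow_enorm_toReal hp₀ hp_top, enorm_eq_self, lintegral_count]
    rwa [tsum_eq_zero_add' ENNReal.summable]

theorem eLpNorm_ennreal_const_mul (f : X → ℝ≥0∞) {a : ℝ≥0∞} (ha : a ≠ ∞) :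
    eLpNorm (fun x => a * f x) p μ = a * eLpNorm f p μ := by
  have hle (b : ℝ≥0) (g : X → ℝ≥0∞) : eLpNorm (fun x => b * g x) p μ ≤ b * eLpNorm g p μ :=
    eLpNorm_le_nnreal_smul_eLpNorm_of_ae_le_mul' (.of_forall fun x => le_rfl) p
  lift a to ℝ≥0 using ha
  rcases eq_or_ne a 0 with rfl | ha
  · simp
  refine (hle a f).antisymm (ENNReal.mul_le_of_le_div' ?_)
  rw [ENNReal.div_eq_inv_mul, ← ENNReal.coe_inv ha]
  simpa only [← mul_assoc, ← ENNReal.coe_mul, inv_mul_cancel₀ ha, ENNReal.coe_one, one_mul]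
    using hle a⁻¹ fun x => a * f x

theorem eLpNorm_rpow_recip_mul {w g : X → ℝ≥0∞} (hw : AEMeasurable w μ)
    (hw_ne_zero : ∀ᵐ x ∂μ, w x ≠ 0) (hw_lt_top : ∀ᵐ x ∂μ, w x < ∞) (hp : p ≠ 0) :
    eLpNorm (fun x => w x ^ recip p * g x) p μ = eLpNorm g p (μ.withDensity w) := by
  rcases eq_or_ne p ∞ with rfl | hp_top
  · simp only [recip, ENNReal.inv_top, ENNReal.toReal_zero, ENNReal.rpow_zero, one_mul,
      eLpNorm_exponent_top]
    exact le_antisymm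
      (eLpNormEssSup_mono_measure _ (withDensity_absolutelyContinuous' hw hw_ne_zero))
      (eLpNormEssSup_mono_measure _ (withDensity_absolutelyContinuous _ _))
  · have hp_pos : 0 < p.toReal := ENNReal.toReal_pos hp hp_top
    simp only [eLpNorm_eq_lintegral_rpow_enorm_toReal hp hp_top, enorm_eq_self,
      ENNReal.mul_rpow_of_nonneg _ _ hp_pos.le, ← ENNReal.rpow_mul, recip, ENNReal.toReal_inv,
      inv_mul_cancel₀ hp_pos.ne', ENNReal.rpow_one]
    rw [lintegral_withDensity_eq_lintegral_mul_non_measurable₀ _ hw hw_lt_top]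
    rfl

theorem eLpNorm_restrict_union_le {f : X → ℝ≥0∞} (hf : AEStronglyMeasurable f μ) {s t : Set X}
    (hs : MeasurableSet s) (ht : MeasurableSet t) (hp : 1 ≤ p) :
    eLpNorm f p (μ.restrict (s ∪ t)) ≤ eLpNorm f p (μ.restrict s) + eLpNorm f p (μ.restrict t) := by
  simp only [← eLpNorm_indicator_eq_eLpNorm_restrict hs,
    ← eLpNorm_indicator_eq_eLpNorm_restrict ht,
    ← eLpNorm_indicator_eq_eLpNorm_restrict (hs.union ht)]
  refine le_trans (eLpNorm_mono_enorm fun x => ?_) (eLpNorm_add_le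
    (hf.indicator hs) (hf.indicator ht) hp)
  simp only [enorm_eq_self, Pi.add_apply]
  by_cases hxs : x ∈ s <;> by_cases hxt : x ∈ t <;> simp [hxs, hxt]

end LpNorms

section SequenceRearrangement

theorem eLpNorm_two_count_sq {ι : Type*} [MeasurableSpace ι] [MeasurableSingletonClass ι]
    (y : ι → ℝ≥0∞) : eLpNorm y 2 Measure.count ^ 2 = ∑' n, y n ^ 2 := by
  rw [eLpNorm_eq_lintegral_rpow_enorm_toReal (by simp) (by simp), ← ENNReal.rpow_natCast,
    ← ENNReal.rpow_mul]
  simp [lintegral_count]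

theorem tsum_sq_le_of_encard_lt_le {ι κ : Type*} (y : ι → ℝ≥0∞) (z : κ → ℝ≥0∞)
    (hyz : ∀ s, {i | s < y i}.encard ≤ {k | s < z k}.encard) : ∑' i, y i ^ 2 ≤ ∑' k, z k ^ 2 := by
  let _ : MeasurableSpace ι := ⊤
  let _ : MeasurableSpace κ := ⊤
  rw [← eLpNorm_two_count_sq, ← eLpNorm_two_count_sq]
  gcongr
  refine eLpNorm_le_of_measure_lt_le measurable_from_top.aemeasurable
    measurable_from_top.aemeasurable (by simp) fun s => ?_
  rw [Measure.count_apply MeasurableSpace.measurableSet_top,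
    Measure.count_apply MeasurableSpace.measurableSet_top]
  exact_mod_cast hyz s

variable {ι : Type} (c : ι → ℂ)

theorem seqRearr_antitone : Antitone (seqRearr c) := fun i j hij =>
  sInf_le_sInf fun _ hs => le_trans (mem_ofPred_eq ▸ hs) (by exact_mod_cast hij)

theorem lt_seqRearr_iff {s : ℝ≥0∞} {k : ℕ} :
    s < seqRearr c k ↔ (k : ℕ∞) < {n | s < ‖c n‖ₑ}.encard := by
  refine ⟨fun h => lt_of_not_ge fun hk => h.not_ge (sInf_le hk), fun h => ?_⟩
  obtain ⟨F, hF, hF_card⟩ : ∃ F ⊆ {n | s < ‖c n‖ₑ}, F.encard = (k + 1 : ℕ) :=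
    exists_subset_encard_eq (by exact_mod_cast Order.add_one_le_of_lt h)
  have hF_nonempty : F.Nonempty := by
    rw [← encard_pos, hF_card]
    exact_mod_cast k.succ_pos
  obtain ⟨a, ha, ha_min⟩ :=
    exists_min_image F (fun n => ‖c n‖ₑ) (finite_of_encard_eq_coe hF_card) hF_nonempty
  refine (hF ha).trans_le (le_sInf fun r hr => le_of_not_gt fun hra => ?_)
  have hF_le : F.encard ≤ k :=
    (encard_le_encard fun n hn => hra.trans_le (ha_min n hn)).trans hr
  rw [hF_card] at hF_le
  exact absurd (by exact_mod_cast hF_le) k.lt_succ_self.not_ge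

theorem encard_lt_seqRearr (s : ℝ≥0∞) :
    {k : ℕ | s < seqRearr c k}.encard = {n | s < ‖c n‖ₑ}.encard := by
  simp only [lt_seqRearr_iff]
  cases {n | s < ‖c n‖ₑ}.encard using ENat.recTopCoe with
  | top => simp
  | coe n =>
    have hrange : {k : ℕ | (k : ℕ∞) < n} = (Finset.range n : Set ℕ) := by ext k; simp
    rw [hrange, encard_coe_eq_coe_finsetCard, Finset.card_range]

/-- The indices of the coefficients that exceed `c^*_{k+1}`; there are at most `k` of them. -/
def largeIndices (k : ℕ) : Set ι := {n | seqRearr c k < ‖c n‖ₑ}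

theorem encard_largeIndices_le (k : ℕ) : (largeIndices c k).encard ≤ k :=
  not_lt.1 fun h => lt_irrefl _ ((lt_seqRearr_iff c).2 h)

/-- The norm `(∑_{k > K} (c_k^*)²)^{1/2}` of the tail of the rearrangement. -/
def tailNorm (K : ℕ) : ℝ≥0∞ := eLpNorm (fun k => seqRearr c (k + K)) 2 Measure.count

theorem tailNorm_sq (K : ℕ) : tailNorm c K ^ 2 = ∑' k, seqRearr c (k + K) ^ 2 :=
  eLpNorm_two_count_sq _

theorem tsum_enorm_sq_le_tailNorm_sq : ∑' n, ‖c n‖ₑ ^ 2 ≤ tailNorm c 0 ^ 2 := by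
  rw [tailNorm_sq]
  exact tsum_sq_le_of_encard_lt_le _ _ fun s => (encard_lt_seqRearr c s).ge

theorem tsum_sq_min_le {a : ℕ → ℝ≥0∞} (ha : Antitone a) (K : ℕ) :
    ∑' k, min (a k) (a (2 * K)) ^ 2 ≤ 2 * ∑' k, a (k + K) ^ 2 := by
  rw [← Summable.sum_add_tsum_nat_add' (k := K) ENNReal.summable, two_mul (∑' k, _)]
  gcongr with k
  · refine le_trans (Finset.sum_le_sum fun k hk => ?_) (ENNReal.sum_le_tsum (Finset.range K))
    gcongr
    exact (min_le_right _ _).trans (ha (by have := Finset.mem_range.1 hk; omega))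
  · exact min_le_left _ _

theorem encard_lt_enorm_indicator_le (k : ℕ) (s : ℝ≥0∞) :
    {n | s < ‖(largeIndices c k)ᶜ.indicator c n‖ₑ}.encard ≤
      {j | s < min (seqRearr c j) (seqRearr c k)}.encard := by
  rcases lt_or_ge s (seqRearr c k) with hs | hs
  · simp only [lt_min_iff, hs, and_true, encard_lt_seqRearr]
    exact encard_le_encard fun n (hn : s < _) => hn.trans_le (enorm_indicator_le_enorm_self c n)
  · have hempty : {n | s < ‖(largeIndices c k)ᶜ.indicator c n‖ₑ} = ∅ := by
      refine eq_empty_of_forall_notMem fun n (hn : s < _) => ?_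
      by_cases hmem : n ∈ largeIndices c k
      · simp [hmem] at hn
      · rw [indicator_of_mem (mem_compl hmem)] at hn
        exact hmem (hs.trans_lt hn)
    simp [hempty]

theorem tsum_enorm_sq_indicator_compl_largeIndices_le (K : ℕ) :
    ∑' n, ‖(largeIndices c (2 * K))ᶜ.indicator c n‖ₑ ^ 2 ≤ 2 * tailNorm c K ^ 2 := by
  rw [tailNorm_sq]
  exact (tsum_sq_le_of_encard_lt_le _ _ (encard_lt_enorm_indicator_le c (2 * K))).trans
    (tsum_sq_min_le (seqRearr_antitone c) K)

end SequenceRearrangement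

section FunctionRearrangement

theorem rearr_antitone (f : ℝ → ℂ) : Antitone (rearr f) := fun _ _ hab =>
  sInf_le_sInf fun _ hs => le_trans hs (ENNReal.ofReal_le_ofReal hab)

theorem rearr_le_eLpNorm_top_add {f g h : ℝ → ℂ} (hf : f =ᵐ[μ01] g + h) (t : ℝ) :
    rearr f t ≤ eLpNorm g ∞ μ01 + rearr h t := by
  rw [rearr, rearr, ENNReal.add_sInf]
  refine le_iInf₂ fun s hs => sInf_le (le_trans (measure_mono_ae ?_) hs)
  filter_upwards [hf, ae_le_eLpNormEssSup (f := g) (μ := μ01)] with x hfx hgx hx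
  refine lt_of_add_lt_add_left (lt_of_lt_of_le (hx : _ < ‖f x‖ₑ) ?_)
  rw [hfx]
  exact (enorm_add_le _ _).trans (by gcongr; exact hgx)

theorem volume_lt_rearr_le (f : ℝ → ℂ) (s : ℝ≥0∞) :
    volume ({u | s < rearr f u} ∩ Ioi 0) ≤ μ01 {x | s < ‖f x‖ₑ} := by
  rcases eq_or_ne (μ01 {x | s < ‖f x‖ₑ}) ∞ with htop | hfin
  · exact htop ▸ le_top
  have hsub : {u | s < rearr f u} ∩ Ioi 0 ⊆ Ioo 0 (μ01 {x | s < ‖f x‖ₑ}).toReal := by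
    rintro u ⟨hu, hu_pos⟩
    refine ⟨hu_pos, lt_of_not_ge fun hle => (mem_ofPred_eq ▸ hu).not_ge (sInf_le ?_)⟩
    exact ENNReal.le_ofReal_iff_toReal_le hfin (le_of_lt hu_pos) |>.2 hle
  refine (measure_mono hsub).trans (le_of_eq ?_)
  rw [Real.volume_Ioo, sub_zero, ENNReal.ofReal_toReal hfin]

theorem eLpNorm_rearr_le {f : ℝ → ℂ} (hf : AEStronglyMeasurable f μ01) {p : ℝ≥0∞} (hp : p ≠ ∞)
    (t : ℝ) : eLpNorm (rearr f) p (volume.restrict (Ioo 0 t)) ≤ eLpNorm f p μ01 := by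
  have hmeas := (rearr_antitone f).measurable
  rw [← eLpNorm_enorm f]
  refine eLpNorm_le_of_measure_lt_le hmeas.aemeasurable hf.enorm hp fun s => ?_
  rw [Measure.restrict_apply (measurableSet_lt measurable_const hmeas)]
  exact (measure_mono (inter_subset_inter_right _ Ioo_subset_Ioi_self)).trans
    (volume_lt_rearr_le f s)

/-- The function `t ↦ (∫_0^t f^*(u)² du)^{1/2}`. -/
def partialL2 (f : ℝ → ℂ) (t : ℝ) : ℝ≥0∞ := eLpNorm (rearr f) 2 (volume.restrict (Ioo 0 t))

theorem partialL2_mono (f : ℝ → ℂ) : Monotone (partialL2 f) := fun _ _ hab =>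
  eLpNorm_mono_measure _ (Measure.restrict_mono (Ioo_subset_Ioo_right hab) le_rfl)

theorem eLpNorm_two_const_restrict_Ioo (a : ℝ≥0∞) (t : ℝ) :
    eLpNorm (fun _ => a) 2 (volume.restrict (Ioo 0 t)) = a * ENNReal.ofReal t ^ (1 / 2 : ℝ) := by
  rw [eLpNorm_const' _ (by simp) (by simp)]
  simp

theorem sqrt_mul_rearr_le_partialL2 (f : ℝ → ℂ) (t : ℝ) :
    ENNReal.ofReal t ^ (1 / 2 : ℝ) * rearr f t ≤ partialL2 f t := by
  rw [mul_comm, ← eLpNorm_two_const_restrict_Ioo]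
  refine eLpNorm_mono_enorm_ae ?_
  filter_upwards [ae_restrict_mem measurableSet_Ioo] with u hu
  exact rearr_antitone f hu.2.le

theorem partialL2_le_of_ae_eq_add {f g h : ℝ → ℂ} (hh : AEStronglyMeasurable h μ01)
    (hf : f =ᵐ[μ01] g + h) (t : ℝ) :
    partialL2 f t ≤ eLpNorm g ∞ μ01 * ENNReal.ofReal t ^ (1 / 2 : ℝ) + eLpNorm h 2 μ01 := by
  set A := eLpNorm g ∞ μ01
  calc partialL2 f t
      ≤ eLpNorm ((fun _ => A) + rearr h) 2 (volume.restrict (Ioo 0 t)) :=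
        eLpNorm_mono_enorm fun u => rearr_le_eLpNorm_top_add hf u
    _ ≤ eLpNorm (fun _ => A) 2 (volume.restrict (Ioo 0 t)) + partialL2 h t :=
        eLpNorm_add_le aestronglyMeasurable_const
          (rearr_antitone h).measurable.aestronglyMeasurable (by simp)
    _ ≤ A * ENNReal.ofReal t ^ (1 / 2 : ℝ) + eLpNorm h 2 μ01 := by
        rw [eLpNorm_two_const_restrict_Ioo]
        gcongr
        exact eLpNorm_rearr_le hh (by simp) t

end FunctionRearrangement

section OrthonormalSeries

variable {𝕜 ι E : Type*} [RCLike 𝕜] [NormedAddCommGroup E]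

theorem enorm_sq_of_hasSum_orthonormal [InnerProductSpace 𝕜 E] {φ : ι → E}
    (hφ : Orthonormal 𝕜 φ) {c : ι → 𝕜} {f : E} (hf : HasSum (fun n => c n • φ n) f) :
    ‖f‖ₑ ^ 2 = ∑' n, ‖c n‖ₑ ^ 2 := by
  have hpartial (S : Finset ι) : ‖∑ n ∈ S, c n • φ n‖ₑ ^ 2 = ∑ n ∈ S, ‖c n‖ₑ ^ 2 := by
    have hnorm : ‖∑ n ∈ S, c n • φ n‖ ^ 2 = ∑ n ∈ S, ‖c n‖ ^ 2 := by
      simpa using hφ.orthogonalFamily.norm_sum c S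
    simp only [← ofReal_norm, ← ENNReal.ofReal_pow (norm_nonneg _), hnorm]
    exact ENNReal.ofReal_sum_of_nonneg fun n _ => by positivity
  have hlim : HasSum (fun n => ‖c n‖ₑ ^ 2) (‖f‖ₑ ^ 2) := by
    simp only [HasSum, ← hpartial]
    exact (((ENNReal.continuous_pow 2).comp continuous_enorm).tendsto f).comp hf
  exact hlim.tsum_eq.symm

theorem summable_smul_of_orthonormal [InnerProductSpace 𝕜 E] [CompleteSpace E] {φ : ι → E}
    (hφ : Orthonormal 𝕜 φ) {c : ι → 𝕜} (hc : ∑' n, ‖c n‖ₑ ^ 2 ≠ ∞) :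
    Summable fun n => c n • φ n := by
  refine (hφ.orthogonalFamily.summable_iff_norm_sq_summable c).2 ?_
  have hnn : Summable fun n => ‖c n‖₊ ^ 2 :=
    ENNReal.tsum_coe_ne_top_iff_summable.1 (by simpa [enorm_eq_nnnorm] using hc)
  simpa using NNReal.summable_coe.2 hnn

theorem eLpNorm_top_sum_smul_le [NormedSpace 𝕜 E] {X : Type*} [MeasurableSpace X] {μ : Measure X}
    {p M : ℝ≥0∞} {φ : ι → Lp E p μ} (hM : ∀ n, eLpNorm (φ n) ∞ μ ≤ M) (c : ι → 𝕜)
    (S : Finset ι) : eLpNorm (∑ n ∈ S, c n • φ n : Lp E p μ) ∞ μ ≤ (∑ n ∈ S, ‖c n‖ₑ) * M := by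
  rw [eLpNorm_congr_ae (Lp.coeFn_finsetSum S fun n => c n • φ n), Finset.sum_mul]
  refine (eLpNorm_sum_le (fun n _ => Lp.aestronglyMeasurable _) le_top).trans ?_
  gcongr with n
  rw [eLpNorm_congr_ae (Lp.coeFn_smul (c n) (φ n)), eLpNorm_const_smul]
  gcongr
  exact hM n

theorem sum_le_sqrt_card_mul (S : Finset ι) (a : ι → ℝ≥0∞) :
    ∑ n ∈ S, a n ≤ (S.card : ℝ≥0∞) ^ (1 / 2 : ℝ) * (∑ n ∈ S, a n ^ 2) ^ (1 / 2 : ℝ) := by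
  simpa using ENNReal.inner_le_Lp_mul_Lq S (fun _ => 1) a Real.HolderConjugate.two_two

end OrthonormalSeries

section BasicEstimate

variable {ι : Type} {φ : ι → Lp ℂ 2 μ01} {M : ℝ≥0∞} {c : ι → ℂ} {f : Lp ℂ 2 μ01}

theorem eLpNorm_top_sum_smul_le_tailNorm (hM : ∀ n, eLpNorm (φ n) ∞ μ01 ≤ M) (c : ι → ℂ)
    {S : Finset ι} {k : ℕ} (hS : S.card ≤ k) :
    eLpNorm (∑ n ∈ S, c n • φ n : Lp ℂ 2 μ01) ∞ μ01 ≤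
      M * (k : ℝ≥0∞) ^ (1 / 2 : ℝ) * tailNorm c 0 := by
  have hsqrt : (∑ n ∈ S, ‖c n‖ₑ ^ 2) ^ (1 / 2 : ℝ) ≤ tailNorm c 0 := by
    rw [one_div, ENNReal.rpow_inv_le_iff two_pos, ENNReal.rpow_two]
    exact (ENNReal.sum_le_tsum S).trans (tsum_enorm_sq_le_tailNorm_sq c)
  calc eLpNorm (∑ n ∈ S, c n • φ n : Lp ℂ 2 μ01) ∞ μ01
      ≤ (∑ n ∈ S, ‖c n‖ₑ) * M := eLpNorm_top_sum_smul_le hM c S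
    _ ≤ (k : ℝ≥0∞) ^ (1 / 2 : ℝ) * tailNorm c 0 * M := by
        grw [sum_le_sqrt_card_mul, hsqrt, hS]
    _ = M * (k : ℝ≥0∞) ^ (1 / 2 : ℝ) * tailNorm c 0 := by ring

/-- The second summand is the `L_2`-norm of the series without its `2K` largest coefficients, the
first one bounds those by the supremum norm. -/
theorem partialL2_le_of_hasSum (hφ : Orthonormal ℂ φ) (hM : ∀ n, eLpNorm (φ n) ∞ μ01 ≤ M)
    (hf : HasSum (fun n => c n • φ n) f) (t : ℝ) (K : ℕ) :
    partialL2 f t ≤ M * ((2 * K : ℕ) : ℝ≥0∞) ^ (1 / 2 : ℝ) * tailNorm c 0 *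
      ENNReal.ofReal t ^ (1 / 2 : ℝ) + 2 * tailNorm c K := by
  have hlarge := encard_largeIndices_le c (2 * K)
  obtain ⟨S, hS⟩ := (finite_of_encard_le_coe hlarge).exists_finset_coe
  have hS_card : S.card ≤ 2 * K := by
    rw [← hS, encard_coe_eq_coe_finsetCard] at hlarge
    exact_mod_cast hlarge
  set g : Lp ℂ 2 μ01 := ∑ n ∈ S, c n • φ n
  have hrest : HasSum (fun n => (largeIndices c (2 * K))ᶜ.indicator c n • φ n) (f - g) := by
    rw [← indicator_smul_left, ← hS, ← hasSum_subtype_iff_indicator]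
    exact S.hasSum_iff_compl.1 hf
  have hrest_norm : ‖f - g‖ₑ ≤ 2 * tailNorm c K := by
    refine (ENNReal.pow_le_pow_left_iff two_ne_zero).1 ?_
    calc ‖f - g‖ₑ ^ 2 ≤ 2 * tailNorm c K ^ 2 :=
          (enorm_sq_of_hasSum_orthonormal hφ hrest).trans_le
            (tsum_enorm_sq_indicator_compl_largeIndices_le c K)
      _ ≤ (2 * tailNorm c K) ^ 2 := by
          rw [mul_pow]
          gcongr
          norm_num
  have hsplit : f =ᵐ[μ01] g + (f - g : Lp ℂ 2 μ01) := by
    simpa only [add_sub_cancel] using Lp.coeFn_add g (f - g)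
  refine (partialL2_le_of_ae_eq_add (Lp.aestronglyMeasurable _) hsplit t).trans ?_
  rw [← Lp.enorm_def]
  gcongr
  exact eLpNorm_top_sum_smul_le_tailNorm hM c hS_card

theorem partialL2_le_tailNorm_zero (hφ : Orthonormal ℂ φ) (hf : HasSum (fun n => c n • φ n) f)
    (t : ℝ) : partialL2 f t ≤ 2 * tailNorm c 0 := by
  simpa using partialL2_le_of_hasSum hφ (M := ∞) (fun _ => le_top) hf t 0

end BasicEstimate

section GeometricNorm

theorem two_rpow_ne_top (a : ℝ) : (2 : ℝ≥0∞) ^ a ≠ ∞ :=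
  ENNReal.rpow_ne_top_of_ne_zero two_ne_zero ENNReal.ofNat_ne_top

theorem two_rpow_add (a b : ℝ) : (2 : ℝ≥0∞) ^ (a + b) = 2 ^ a * 2 ^ b :=
  ENNReal.rpow_add _ _ two_ne_zero ENNReal.ofNat_ne_top

theorem two_rpow_neg_lt_one {γ : ℝ} (hγ : 0 < γ) : (2 : ℝ≥0∞) ^ (-γ) < 1 :=
  ENNReal.rpow_lt_one_of_one_lt_of_neg ENNReal.one_lt_two (neg_lt_zero.2 hγ)

theorem inv_one_sub_two_rpow_neg_ne_top {γ : ℝ} (hγ : 0 < γ) :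
    (1 - (2 : ℝ≥0∞) ^ (-γ))⁻¹ ≠ ∞ :=
  ENNReal.inv_ne_top.2 (tsub_pos_of_lt (two_rpow_neg_lt_one hγ)).ne'

theorem sum_range_two_rpow_le (γ : ℝ) (k : ℕ) :
    ∑ m ∈ Finset.range k, (2 : ℝ≥0∞) ^ (m * γ) ≤
      2 ^ (-γ) * (1 - (2 : ℝ≥0∞) ^ (-γ))⁻¹ * 2 ^ (k * γ) := by
  have hterm (m : ℕ) (hm : m ∈ Finset.range k) : (2 : ℝ≥0∞) ^ ((k - 1 - m : ℕ) * γ) =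
      2 ^ (-γ) * ((2 : ℝ≥0∞) ^ (-γ)) ^ m * 2 ^ (k * γ) := by
    have hk : ((k - 1 - m : ℕ) : ℝ) = k - 1 - m := by
      rw [Nat.cast_sub, Nat.cast_sub, Nat.cast_one] <;> grind
    rw [← ENNReal.rpow_mul_natCast, ← two_rpow_add, ← two_rpow_add, hk]
    ring_nf
  rw [← Finset.sum_range_reflect, Finset.sum_congr rfl hterm, ← Finset.sum_mul, ← Finset.mul_sum,
    ← ENNReal.tsum_geometric]
  gcongr
  exact ENNReal.sum_le_tsum _

/-- The weighted sequence norm `‖(2 ^ (n γ) y n)‖` in `l_q`, in which the block decompositions of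
all the Lorentz–Zygmund norms are measured. -/
def geomNorm (q : ℝ≥0∞) (γ : ℝ) (y : ℕ → ℝ≥0∞) : ℝ≥0∞ :=
  eLpNorm (fun n : ℕ => (2 : ℝ≥0∞) ^ (n * γ) * y n) q Measure.count

variable {q : ℝ≥0∞} {γ : ℝ} {y z : ℕ → ℝ≥0∞}

theorem geomNorm_mono (h : ∀ n, y n ≤ z n) : geomNorm q γ y ≤ geomNorm q γ z :=
  eLpNorm_mono_enorm fun n => mul_le_mul_right (h n) _

theorem geomNorm_const_mul {a : ℝ≥0∞} (ha : a ≠ ∞) :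
    geomNorm q γ (fun n => a * y n) = a * geomNorm q γ y := by
  simp only [geomNorm, mul_left_comm _ a, eLpNorm_ennreal_const_mul _ ha]

theorem geomNorm_two_rpow_mul (δ : ℝ) :
    geomNorm q γ (fun n => (2 : ℝ≥0∞) ^ (n * δ) * y n) = geomNorm q (γ + δ) y := by
  simp only [geomNorm, mul_add, two_rpow_add, mul_assoc]

theorem geomNorm_add_le (hq : 1 ≤ q) :
    geomNorm q γ (fun n => y n + z n) ≤ geomNorm q γ y + geomNorm q γ z := by
  simp only [geomNorm, mul_add]
  exact eLpNorm_add_le measurable_from_top.aestronglyMeasurable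
    measurable_from_top.aestronglyMeasurable hq

theorem geomNorm_anti {p : ℝ≥0∞} (hq : q ≠ 0) (hqp : q ≤ p) : geomNorm p γ y ≤ geomNorm q γ y :=
  eLpNorm_count_anti _ hq hqp

theorem apply_zero_le_geomNorm (hq : q ≠ 0) : y 0 ≤ geomNorm q γ y := by
  simpa [geomNorm] using
    enorm_le_eLpNorm_count (fun n : ℕ => (2 : ℝ≥0∞) ^ (n * γ) * y n) 0 hq

theorem geomNorm_one_eq_tsum : geomNorm 1 γ y = ∑' n : ℕ, (2 : ℝ≥0∞) ^ (n * γ) * y n := by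
  simp [geomNorm, eLpNorm_one_eq_lintegral_enorm, lintegral_count]

theorem geomNorm_add_shift (k : ℕ) :
    (2 : ℝ≥0∞) ^ (k * γ) * geomNorm q γ (fun n => y (n + k)) =
      eLpNorm (fun n : ℕ => (2 : ℝ≥0∞) ^ ((n + k : ℕ) * γ) * y (n + k)) q Measure.count := by
  rw [geomNorm, ← eLpNorm_ennreal_const_mul _ (two_rpow_ne_top _)]
  congr with n
  rw [← mul_assoc, ← two_rpow_add, Nat.cast_add, add_mul, add_comm]

theorem two_rpow_mul_geomNorm_shift_le (hq : q ≠ 0) (k : ℕ) :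
    (2 : ℝ≥0∞) ^ (k * γ) * geomNorm q γ (fun n => y (n + k)) ≤ geomNorm q γ y := by
  rw [geomNorm_add_shift]
  exact eLpNorm_count_comp_le (fun n : ℕ => (2 : ℝ≥0∞) ^ (n * γ) * y n) hq (add_left_injective k)

theorem geomNorm_le_sum_add_shift (hq : 1 ≤ q) (k : ℕ) :
    geomNorm q γ y ≤ ∑ m ∈ Finset.range k, (2 : ℝ≥0∞) ^ (m * γ) * y m +
      2 ^ (k * γ) * geomNorm q γ (fun n => y (n + k)) := by
  rw [geomNorm_add_shift]
  induction k with
  | zero => simp [geomNorm]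
  | succ k ih =>
    rw [Finset.sum_range_succ, add_assoc]
    refine ih.trans (add_le_add_right ?_ _)
    refine (eLpNorm_count_le_add_succ _ hq).trans_eq ?_
    simp only [zero_add, add_right_comm, add_assoc]

theorem geomNorm_tsum_shift_le (hq : 1 ≤ q) :
    geomNorm q γ (fun n => ∑' i, y (n + i)) ≤ (1 - (2 : ℝ≥0∞) ^ (-γ))⁻¹ * geomNorm q γ y := by
  set r : ℝ≥0∞ := 2 ^ (-γ)
  have hq₀ : q ≠ 0 := (zero_lt_one.trans_le hq).ne'
  calc geomNorm q γ (fun n => ∑' i, y (n + i))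
      ≤ ∑' i : ℕ, geomNorm q γ (fun n => y (n + i)) := by
        simp only [geomNorm, ← ENNReal.tsum_mul_left]
        exact eLpNorm_tsum_le (fun i => measurable_from_top) hq
    _ = ∑' i : ℕ, r ^ i * (2 ^ (i * γ) * geomNorm q γ (fun n => y (n + i))) := by
        congr! 2 with i
        rw [← mul_assoc, ← ENNReal.rpow_mul_natCast, ← two_rpow_add,
          show -γ * i + i * γ = 0 by ring, ENNReal.rpow_zero, one_mul]
    _ ≤ ∑' i : ℕ, r ^ i * geomNorm q γ y := by
        gcongr with i
        exact two_rpow_mul_geomNorm_shift_le hq₀ i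
    _ = (1 - r)⁻¹ * geomNorm q γ y := by rw [ENNReal.tsum_mul_right, ENNReal.tsum_geometric]

end GeometricNorm

section Blocks

/-- The integer `n` with `2 ^ n ≤ x < 2 ^ (n + 1)`, for `1 ≤ x`; junk value `0` for `x < 1`. -/
def level (x : ℝ) : ℕ := Nat.log 2 ⌊x⌋₊

theorem measurable_level : Measurable level :=
  (measurable_from_top (f := fun n : ℕ => Nat.log 2 n)).comp Nat.measurable_floor

theorem le_level_iff {x : ℝ} (hx : 1 ≤ x) {n : ℕ} : n ≤ level x ↔ (2 : ℝ) ^ n ≤ x := by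
  rw [level, Nat.le_log_iff_pow_le one_lt_two (Nat.floor_pos.2 hx).ne',
    Nat.le_floor_iff (zero_le_one.trans hx), Nat.cast_pow, Nat.cast_ofNat]

theorem pow_level_le {x : ℝ} (hx : 1 ≤ x) : (2 : ℝ) ^ level x ≤ x :=
  (le_level_iff hx).1 le_rfl

theorem lt_pow_level_succ {x : ℝ} (hx : 1 ≤ x) : x < (2 : ℝ) ^ (level x + 1) :=
  not_le.1 <| (le_level_iff hx).not.1 (Nat.not_succ_le_self _)

theorem ofReal_two_pow (n : ℕ) : ENNReal.ofReal (2 ^ n) = 2 ^ n := by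
  rw [ENNReal.ofReal_pow zero_le_two, ENNReal.ofReal_ofNat]

theorem two_pow_level_le_ofReal {x : ℝ} (hx : 1 ≤ x) :
    (2 : ℝ≥0∞) ^ level x ≤ ENNReal.ofReal x :=
  ofReal_two_pow _ ▸ ENNReal.ofReal_le_ofReal (pow_level_le hx)

theorem ofReal_le_two_mul_two_pow_level {x : ℝ} (hx : 1 ≤ x) :
    ENNReal.ofReal x ≤ 2 * 2 ^ level x := by
  rw [← pow_succ', ← ofReal_two_pow]
  exact ENNReal.ofReal_le_ofReal (lt_pow_level_succ hx).le

theorem rpow_le_two_rpow_abs_mul {a b : ℝ≥0∞} (hab : a ≤ 2 * b) (hba : b ≤ 2 * a) (β : ℝ) :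
    a ^ β ≤ 2 ^ |β| * b ^ β := by
  rcases le_total 0 β with hβ | hβ
  · rw [abs_of_nonneg hβ, ← ENNReal.mul_rpow_of_nonneg _ _ hβ]
    exact ENNReal.rpow_le_rpow hab hβ
  · obtain ⟨δ, rfl⟩ : ∃ δ, β = -δ := ⟨-β, by ring⟩
    have hδ : 0 ≤ δ := by linarith
    rw [abs_neg, abs_of_nonneg hδ, ENNReal.rpow_neg, ENNReal.rpow_neg]
    calc (a ^ δ)⁻¹ = 2 ^ δ * (2 ^ δ * a ^ δ)⁻¹ := by
          rw [ENNReal.mul_inv (.inl (by simp)) (.inl (two_rpow_ne_top δ)), ← mul_assoc,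
            ENNReal.mul_inv_cancel (by simp) (two_rpow_ne_top δ), one_mul]
      _ ≤ 2 ^ δ * (b ^ δ)⁻¹ := by
          rw [← ENNReal.mul_rpow_of_nonneg _ _ hδ]
          gcongr

theorem ofReal_rpow_le_two_rpow_level {x : ℝ} (hx : 1 ≤ x) (β : ℝ) :
    ENNReal.ofReal x ^ β ≤ 2 ^ |β| * 2 ^ (level x * β) := by
  rw [ENNReal.rpow_mul, ENNReal.rpow_natCast]
  exact rpow_le_two_rpow_abs_mul (ofReal_le_two_mul_two_pow_level hx)
    ((two_pow_level_le_ofReal hx).trans (le_mul_of_one_le_left' one_le_two)) β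

theorem two_rpow_level_le_ofReal_rpow {x : ℝ} (hx : 1 ≤ x) (β : ℝ) :
    (2 : ℝ≥0∞) ^ (level x * β) ≤ 2 ^ |β| * ENNReal.ofReal x ^ β := by
  rw [ENNReal.rpow_mul, ENNReal.rpow_natCast]
  exact rpow_le_two_rpow_abs_mul
    ((two_pow_level_le_ofReal hx).trans (le_mul_of_one_le_left' one_le_two))
    (ofReal_le_two_mul_two_pow_level hx) β

variable {X : Type*}

/-- The set of points at which the weight `l` lies in `[2 ^ m, 2 ^ (m + 1))`. -/
def block (l : X → ℝ) (m : ℕ) : Set X := (fun x => level (l x)) ⁻¹' {m}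

variable [MeasurableSpace X] {ν : Measure X} {l : X → ℝ} {p : ℝ≥0∞}

theorem measurableSet_block (hl : Measurable l) (m : ℕ) : MeasurableSet (block l m) :=
  measurable_level.comp hl (measurableSet_singleton m)

theorem eLpNorm_two_rpow_level_mul (hl : Measurable l) (hp : p ≠ 0) (g : X → ℝ≥0∞) (β : ℝ) :
    eLpNorm (fun x => (2 : ℝ≥0∞) ^ (level (l x) * β) * g x) p ν =
      geomNorm p β (fun m => eLpNorm g p (ν.restrict (block l m))) := by
  rw [eLpNorm_eq_eLpNorm_restrict_fiber _ hp (measurable_level.comp hl), geomNorm]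
  congr! 2 with m
  rw [← eLpNorm_ennreal_const_mul _ (two_rpow_ne_top _)]
  refine eLpNorm_congr_ae ?_
  filter_upwards [ae_restrict_mem (measurableSet_block hl m)] with x hx
  rw [show level (l x) = m from hx]

theorem eLpNorm_weight_mul_le_geomNorm (hl : Measurable l) (hl_one : ∀ x, 1 ≤ l x) (hp : p ≠ 0)
    (g : X → ℝ≥0∞) (β : ℝ) :
    eLpNorm (fun x => ENNReal.ofReal (l x) ^ β * g x) p ν ≤
      2 ^ |β| * geomNorm p β (fun m => eLpNorm g p (ν.restrict (block l m))) := by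
  rw [← eLpNorm_two_rpow_level_mul hl hp, ← eLpNorm_ennreal_const_mul _ (two_rpow_ne_top _)]
  refine eLpNorm_mono_enorm fun x => ?_
  simp only [enorm_eq_self, ← mul_assoc]
  gcongr
  exact ofReal_rpow_le_two_rpow_level (hl_one x) β

theorem geomNorm_le_eLpNorm_weight_mul (hl : Measurable l) (hl_one : ∀ x, 1 ≤ l x) (hp : p ≠ 0)
    (g : X → ℝ≥0∞) (β : ℝ) :
    geomNorm p β (fun m => eLpNorm g p (ν.restrict (block l m))) ≤
      2 ^ |β| * eLpNorm (fun x => ENNReal.ofReal (l x) ^ β * g x) p ν := by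
  rw [← eLpNorm_two_rpow_level_mul hl hp, ← eLpNorm_ennreal_const_mul _ (two_rpow_ne_top _)]
  refine eLpNorm_mono_enorm fun x => ?_
  simp only [enorm_eq_self, ← mul_assoc]
  gcongr
  exact two_rpow_level_le_ofReal_rpow (hl_one x) β

end Blocks

section FunctionBlocks

theorem recip_nonneg (q : ℝ≥0∞) : 0 ≤ recip q := ENNReal.toReal_nonneg

theorem recip_two : recip 2 = 1 / 2 := by simp [recip]

theorem recip_anti {p q : ℝ≥0∞} (hp : p ≠ 0) (hpq : p ≤ q) : recip q ≤ recip p :=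
  ENNReal.toReal_mono (ENNReal.inv_ne_top.2 hp) (ENNReal.inv_le_inv.2 hpq)

/-- The logarithmic weight of the Lorentz–Zygmund function spaces. -/
def logWeight (t : ℝ) : ℝ := 1 + |Real.log t|

theorem one_le_logWeight (t : ℝ) : 1 ≤ logWeight t :=
  le_add_of_nonneg_right (abs_nonneg _)

theorem measurable_logWeight : Measurable logWeight :=
  measurable_const.add Real.measurable_log.norm

theorem logWeight_of_mem_Ioo {t : ℝ} (ht : t ∈ Ioo 0 1) : logWeight t = 1 - Real.log t := by
  rw [logWeight, abs_of_nonpos (Real.log_nonpos ht.1.le ht.2.le), sub_eq_add_neg]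

/-- The measure `dt / t` on `(0, 1)`; it absorbs the factor `t ^ (-1 / q)` of the norms. -/
def haar01 : Measure ℝ :=
  (volume.restrict (Ioo 0 1)).withDensity fun t => (ENNReal.ofReal t)⁻¹

theorem ae_haar01_mem_Ioo : ∀ᵐ t ∂haar01, t ∈ Ioo (0 : ℝ) 1 :=
  (withDensity_absolutelyContinuous _ _).ae_le (ae_restrict_mem measurableSet_Ioo)

theorem eLpNorm_haar01_restrict {s : Set ℝ} (hs : MeasurableSet s) (g : ℝ → ℝ≥0∞) {p : ℝ≥0∞}
    (hp : p ≠ 0) :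
    eLpNorm g p (haar01.restrict s) =
      eLpNorm (fun t => (ENNReal.ofReal t)⁻¹ ^ recip p * g t) p
        ((volume.restrict (Ioo 0 1)).restrict s) := by
  have hmeas : Measurable fun t : ℝ => (ENNReal.ofReal t)⁻¹ := ENNReal.measurable_ofReal.inv
  rw [haar01, restrict_withDensity hs, eLpNorm_rpow_recip_mul hmeas.aemeasurable _ _ hp]
  · exact .of_forall fun t => by simp
  · filter_upwards [ae_restrict_of_ae (ae_restrict_mem measurableSet_Ioo)] with t ht
    simpa using ht.1

theorem eLpNorm_rpow_sub_recip_mul {p : ℝ≥0∞} (hp : p ≠ 0) (a β : ℝ) (g : ℝ → ℝ≥0∞) :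
    eLpNorm (fun t => ENNReal.ofReal (t ^ (a - recip p) * (1 + |Real.log t|) ^ β) * g t) p
        (volume.restrict (Ioo 0 1)) =
      eLpNorm (fun t => ENNReal.ofReal (logWeight t) ^ β * (ENNReal.ofReal t ^ a * g t)) p
        haar01 := by
  rw [← Measure.restrict_univ (μ := haar01), eLpNorm_haar01_restrict .univ _ hp,
    Measure.restrict_univ]
  refine eLpNorm_congr_ae ?_
  filter_upwards [ae_restrict_mem measurableSet_Ioo] with t ht
  have ht₀ : ENNReal.ofReal t ≠ 0 := (ENNReal.ofReal_pos.2 ht.1).ne'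
  rw [ENNReal.ofReal_mul (Real.rpow_nonneg ht.1.le _), ← ENNReal.ofReal_rpow_of_pos ht.1,
    ← logWeight, ← ENNReal.ofReal_rpow_of_pos (zero_lt_one.trans_le (one_le_logWeight t)),
    sub_eq_add_neg, ENNReal.rpow_add _ _ ht₀ ENNReal.ofReal_ne_top, ENNReal.inv_rpow,
    ENNReal.rpow_neg]
  ring

theorem lzNorm_two_eq {p : ℝ≥0∞} (hp : p ≠ 0) (β : ℝ) (f : ℝ → ℂ) :
    lzNorm 2 p β f = eLpNorm (fun t => ENNReal.ofReal (logWeight t) ^ β *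
      (ENNReal.ofReal t ^ (1 / 2 : ℝ) * rearr f t)) p haar01 := by
  rw [lzNorm, recip_two, eLpNorm_rpow_sub_recip_mul hp]

theorem limNorm_two_eq {q : ℝ≥0∞} (hq : q ≠ 0) (α : ℝ) (f : ℝ → ℂ) :
    limNorm 2 q α 2 f =
      eLpNorm (fun t => ENNReal.ofReal (logWeight t) ^ α * partialL2 f t) q haar01 := by
  simpa [limNorm, partialL2] using eLpNorm_rpow_sub_recip_mul hq 0 α (partialL2 f)

/-- The right endpoint of the `m`-th block `{t ∈ (0, 1) | 2 ^ m ≤ 1 + |log t| < 2 ^ (m + 1)}`. -/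
def blockTime (m : ℕ) : ℝ := Real.exp (1 - 2 ^ m)

theorem blockTime_pos (m : ℕ) : 0 < blockTime m := Real.exp_pos _

theorem blockTime_succ_le (m : ℕ) : blockTime (m + 1) ≤ blockTime m := by
  unfold blockTime
  gcongr <;> simp

theorem mem_Ioc_of_mem_block {m : ℕ} {t : ℝ} (ht : t ∈ Ioo (0 : ℝ) 1)
    (hm : t ∈ block logWeight m) : t ∈ Ioc (blockTime (m + 1)) (blockTime m) := by
  have hlevel : level (logWeight t) = m := hm
  have hle := pow_level_le (one_le_logWeight t)
  have hlt := lt_pow_level_succ (one_le_logWeight t)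
  rw [hlevel, logWeight_of_mem_Ioo ht] at hle hlt
  constructor
  · rw [blockTime, ← Real.lt_log_iff_exp_lt ht.1]
    linarith
  · rw [blockTime, ← Real.log_le_iff_le_exp ht.1]
    linarith

theorem ae_haar01_block_le_blockTime (m : ℕ) :
    ∀ᵐ t ∂(haar01.restrict (block logWeight m)), t ≤ blockTime m := by
  filter_upwards [ae_restrict_mem (measurableSet_block measurable_logWeight m),
    ae_restrict_of_ae ae_haar01_mem_Ioo] with t htm ht
  exact (mem_Ioc_of_mem_block ht htm).2

theorem lintegral_Ioc_inv {a b : ℝ} (ha : 0 < a) (hab : a ≤ b) :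
    ∫⁻ t in Ioc a b, (ENNReal.ofReal t)⁻¹ = ENNReal.ofReal (Real.log (b / a)) := by
  have hpos (t : ℝ) (ht : t ∈ Ioc a b) : 0 < t := ha.trans ht.1
  have hint : IntervalIntegrable (fun t : ℝ => t⁻¹) volume a b :=
    intervalIntegral.intervalIntegrable_inv
      (fun t ht => (ha.trans_le (uIcc_of_le hab ▸ ht).1).ne') continuousOn_id
  rw [← integral_inv_of_pos ha (ha.trans_le hab), intervalIntegral.integral_of_le hab,
    ofReal_integral_eq_lintegral_ofReal
      ((intervalIntegrable_iff_integrableOn_Ioc_of_le hab).1 hint)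
      (ae_restrict_of_forall_mem measurableSet_Ioc fun t ht => (inv_pos.2 (hpos t ht)).le)]
  exact setLIntegral_congr_fun measurableSet_Ioc fun t ht =>
    (ENNReal.ofReal_inv_of_pos (hpos t ht)).symm

theorem restrict_logBlock_le (m : ℕ) :
    (volume.restrict (Ioo 0 1)).restrict (block logWeight m) ≤
      volume.restrict (Ioc (blockTime (m + 1)) (blockTime m)) := by
  rw [Measure.restrict_restrict (measurableSet_block measurable_logWeight m)]
  exact Measure.restrict_mono (fun t ht => mem_Ioc_of_mem_block ht.2 ht.1) le_rfl

theorem haar01_block_le (m : ℕ) : haar01 (block logWeight m) ≤ 2 ^ m := by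
  rw [haar01, withDensity_apply _ (measurableSet_block measurable_logWeight m)]
  refine (lintegral_mono' (restrict_logBlock_le m) le_rfl).trans_eq ?_
  rw [lintegral_Ioc_inv (blockTime_pos _) (blockTime_succ_le m), blockTime, blockTime,
    ← Real.exp_sub, Real.log_exp, ← ofReal_two_pow]
  ring_nf

theorem haar01_block_rpow_le (m : ℕ) {a : ℝ} (ha : 0 ≤ a) :
    haar01 (block logWeight m) ^ a ≤ 2 ^ (m * a) := by
  rw [ENNReal.rpow_mul, ENNReal.rpow_natCast]
  exact ENNReal.rpow_le_rpow (haar01_block_le m) ha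

theorem eLpNorm_two_block_le (f : ℝ → ℂ) (m : ℕ) :
    eLpNorm (fun t => ENNReal.ofReal t ^ (1 / 2 : ℝ) * rearr f t) 2
      (haar01.restrict (block logWeight m)) ≤ partialL2 f (blockTime m) := by
  rw [eLpNorm_haar01_restrict (measurableSet_block measurable_logWeight m) _ two_ne_zero]
  calc _ = eLpNorm (rearr f) 2 ((volume.restrict (Ioo 0 1)).restrict (block logWeight m)) := by
        refine eLpNorm_congr_ae (ae_restrict_of_ae ?_)
        filter_upwards [ae_restrict_mem measurableSet_Ioo] with t ht
        rw [recip_two, ← mul_assoc, ENNReal.inv_rpow, ENNReal.inv_mul_cancel, one_mul]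
        · simp [ht.1]
        · exact ENNReal.rpow_ne_top_of_nonneg (by norm_num) ENNReal.ofReal_ne_top
    _ ≤ eLpNorm (rearr f) 2 (volume.restrict (Ioc 0 (blockTime m))) :=
        eLpNorm_mono_measure _ ((restrict_logBlock_le m).trans
          (Measure.restrict_mono (Ioc_subset_Ioc_left (blockTime_pos _).le) le_rfl))
    _ = partialL2 f (blockTime m) := by rw [partialL2, Measure.restrict_congr_set Ioo_ae_eq_Ioc]

theorem limNorm_le_geomNorm {q : ℝ≥0∞} (hq : q ≠ 0) (α : ℝ) (f : ℝ → ℂ) :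
    limNorm 2 q α 2 f ≤
      2 ^ |α| * geomNorm q (α + recip q) fun m => partialL2 f (blockTime m) := by
  rw [limNorm_two_eq hq, ← geomNorm_two_rpow_mul]
  refine (eLpNorm_weight_mul_le_geomNorm measurable_logWeight one_le_logWeight hq _ α).trans ?_
  gcongr
  refine geomNorm_mono fun m => ?_
  have hbound : ∀ᵐ t ∂(haar01.restrict (block logWeight m)),
      ‖partialL2 f t‖ₑ ≤ partialL2 f (blockTime m) := by
    filter_upwards [ae_haar01_block_le_blockTime m] with t ht
    exact partialL2_mono f ht
  refine (eLpNorm_le_of_ae_enorm_bound hbound).trans ?_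
  rw [smul_eq_mul, mul_comm, Measure.restrict_apply_univ, ← ENNReal.toReal_inv]
  gcongr
  exact haar01_block_rpow_le m (recip_nonneg q)

theorem lzNorm_le_geomNorm_of_two_le {q p : ℝ≥0∞} (hq : q ≠ 0) (hp : 2 ≤ p) (hqp : q ≤ p) (γ : ℝ)
    (f : ℝ → ℂ) :
    lzNorm 2 p γ f ≤ 2 ^ |γ| * geomNorm q γ fun m => partialL2 f (blockTime m) := by
  have hp₀ : p ≠ 0 := (zero_lt_two.trans_le hp).ne'
  rw [lzNorm_two_eq hp₀]
  refine (eLpNorm_weight_mul_le_geomNorm measurable_logWeight one_le_logWeight hp₀ _ γ).trans ?_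
  gcongr
  refine (geomNorm_mono fun m => ?_).trans (geomNorm_anti hq hqp)
  refine eLpNorm_le_of_exponent_le_of_bound two_ne_zero hp ?_ (eLpNorm_two_block_le f m)
  filter_upwards [ae_haar01_block_le_blockTime m] with t ht
  exact (sqrt_mul_rearr_le_partialL2 f t).trans (partialL2_mono f ht)

theorem lzNorm_le_geomNorm_of_le_two {q : ℝ≥0∞} (hq : q ≠ 0) (hq_two : q ≤ 2) (α : ℝ)
    (f : ℝ → ℂ) :
    lzNorm 2 q (α + 1 / 2) f ≤
      2 ^ |α + 1 / 2| * geomNorm q (α + recip q) fun m => partialL2 f (blockTime m) := by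
  have hrecip : 0 ≤ recip q - 1 / 2 := sub_nonneg.2 (recip_two ▸ recip_anti hq hq_two)
  rw [lzNorm_two_eq hq, show α + recip q = α + 1 / 2 + (recip q - 1 / 2) by ring,
    ← geomNorm_two_rpow_mul]
  refine (eLpNorm_weight_mul_le_geomNorm measurable_logWeight one_le_logWeight hq _ _).trans ?_
  gcongr
  refine geomNorm_mono fun m => ?_
  have hmeas : Measurable fun t => ENNReal.ofReal t ^ (1 / 2 : ℝ) * rearr f t :=
    (ENNReal.measurable_ofReal.pow_const _).mul (rearr_antitone f).measurable
  refine (eLpNorm_le_eLpNorm_mul_rpow_measure_univ hq_two hmeas.aestronglyMeasurable).trans ?_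
  have hexp : 1 / q.toReal - 1 / (2 : ℝ≥0∞).toReal = recip q - 1 / 2 := by
    simp [recip, ENNReal.toReal_inv]
  rw [hexp, mul_comm, Measure.restrict_apply_univ]
  exact mul_le_mul' (haar01_block_rpow_le m hrecip) (eLpNorm_two_block_le f m)

theorem exists_max_norm_le_geomNorm {q : ℝ≥0∞} (hq : q ≠ 0) (α : ℝ) : ∃ C : ℝ≥0, ∀ f : ℝ → ℂ,
    max (limNorm 2 q α 2 f)
        (max (lzNorm 2 q (α + recip (max q 2)) f) (lzNorm 2 (max q 2) (α + recip q) f)) ≤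
      C * geomNorm q (α + recip q) fun m => partialL2 f (blockTime m) := by
  obtain ⟨β, hβ⟩ : ∃ β : ℝ, ∀ f, lzNorm 2 q (α + recip (max q 2)) f ≤
      2 ^ |β| * geomNorm q (α + recip q) fun m => partialL2 f (blockTime m) := by
    rcases le_total q 2 with h | h
    · rw [max_eq_right h, recip_two]
      exact ⟨_, lzNorm_le_geomNorm_of_le_two hq h α⟩
    · rw [max_eq_left h]
      exact ⟨_, lzNorm_le_geomNorm_of_two_le hq h le_rfl _⟩
  have hlim := limNorm_le_geomNorm hq α
  have hlz := lzNorm_le_geomNorm_of_two_le hq (le_max_right q 2) (le_max_left q 2) (α + recip q)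
  lift (2 : ℝ≥0∞) ^ |α| to ℝ≥0 using two_rpow_ne_top _ with A
  lift (2 : ℝ≥0∞) ^ |β| to ℝ≥0 using two_rpow_ne_top _ with B
  lift (2 : ℝ≥0∞) ^ |α + recip q| to ℝ≥0 using two_rpow_ne_top _ with D
  refine ⟨max A (max B D), fun f => ?_⟩
  rw [ENNReal.coe_max, ENNReal.coe_max, max_mul_of_nonneg _ _ zero_le,
    max_mul_of_nonneg _ _ zero_le]
  exact max_le_max (hlim f) (max_le_max (hβ f) (hlz f))

end FunctionBlocks

section SequenceBlocks

/-- The logarithmic weight `1 + log k` of the Lorentz–Zygmund sequence spaces, at `k = j + 1`. -/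
def seqWeight (j : ℕ) : ℝ := 1 + Real.log ((j : ℝ) + 1)

theorem one_le_seqWeight (j : ℕ) : 1 ≤ seqWeight j :=
  le_add_of_nonneg_right (Real.log_nonneg (by simp))

theorem monotone_seqWeight : Monotone seqWeight := fun i j hij => by
  unfold seqWeight
  gcongr

/-- The measure `∑ k⁻¹ δ_k` over the positive integers `k = j + 1`; it absorbs the factor
`k ^ (-1 / q)` of the norms. -/
def harmonicMeasure : Measure ℕ :=
  Measure.count.withDensity fun j : ℕ => ((j : ℝ≥0∞) + 1)⁻¹

theorem eLpNorm_harmonicMeasure_restrict (s : Set ℕ) (g : ℕ → ℝ≥0∞) {p : ℝ≥0∞} (hp : p ≠ 0) :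
    eLpNorm g p (harmonicMeasure.restrict s) =
      eLpNorm (fun j : ℕ => ((j : ℝ≥0∞) + 1)⁻¹ ^ recip p * g j) p (Measure.count.restrict s) := by
  rw [harmonicMeasure, restrict_withDensity .of_discrete,
    eLpNorm_rpow_recip_mul measurable_from_top.aemeasurable _ _ hp]
  · exact .of_forall fun j => by simp
  · exact .of_forall fun j => by simp

theorem harmonicMeasure_finset (s : Finset ℕ) :
    harmonicMeasure s = ∑ j ∈ s, ((j : ℝ≥0∞) + 1)⁻¹ := by
  rw [harmonicMeasure, withDensity_apply _ .of_discrete, lintegral_finset]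
  simp

theorem harmonicMeasure_range (N : ℕ) :
    harmonicMeasure (Finset.range N) = ENNReal.ofReal (harmonic N : ℚ) := by
  rw [harmonicMeasure_finset, harmonic]
  push_cast
  rw [ENNReal.ofReal_sum_of_nonneg fun j _ => by positivity]
  refine Finset.sum_congr rfl fun j _ => ?_
  rw [ENNReal.ofReal_inv_of_pos (by positivity), ENNReal.ofReal_add j.cast_nonneg zero_le_one,
    ENNReal.ofReal_natCast, ENNReal.ofReal_one]

theorem harmonicMeasure_block_le (m : ℕ) :
    harmonicMeasure (block seqWeight m) ≤ 2 ^ (m + 1) := by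
  set x : ℝ := Real.exp (2 ^ (m + 1) - 1)
  have hx : 1 ≤ x := Real.one_le_exp (sub_nonneg.2 (one_le_pow₀ one_le_two))
  have hsub : block seqWeight m ⊆ (Finset.range ⌊x⌋₊ : Set ℕ) := fun j hj => by
    have hlevel : level (seqWeight j) = m := hj
    have hlt := lt_pow_level_succ (one_le_seqWeight j)
    rw [hlevel, seqWeight] at hlt
    have hj_le : (j : ℝ) + 1 ≤ x := (Real.log_le_iff_le_exp (by positivity)).1 (by linarith)
    simpa using Nat.le_floor (show ((j + 1 : ℕ) : ℝ) ≤ x by exact_mod_cast hj_le)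
  refine (measure_mono hsub).trans ?_
  rw [harmonicMeasure_range, ← ofReal_two_pow]
  refine ENNReal.ofReal_le_ofReal ((harmonic_floor_le_one_add_log x hx).trans_eq ?_)
  rw [Real.log_exp, add_sub_cancel]

theorem two_inv_le_harmonicMeasure_Icc (j : ℕ) :
    2⁻¹ ≤ harmonicMeasure (Finset.Icc (j / 2) j : Finset ℕ) := by
  rw [harmonicMeasure_finset]
  calc (2⁻¹ : ℝ≥0∞) ≤ (Finset.Icc (j / 2) j).card • ((j : ℝ≥0∞) + 1)⁻¹ := by
        rw [nsmul_eq_mul, ← div_eq_mul_inv, ENNReal.le_div_iff_mul_le (by simp) (by simp),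
          mul_comm, ← div_eq_mul_inv, ENNReal.div_le_iff_le_mul (by simp) (by simp), Nat.card_Icc]
        have hcard : j + 1 ≤ (j + 1 - j / 2) * 2 := by omega
        exact_mod_cast hcard
    _ ≤ ∑ i ∈ Finset.Icc (j / 2) j, ((i : ℝ≥0∞) + 1)⁻¹ := by
        refine Finset.card_nsmul_le_sum _ _ _ fun i hi => ?_
        gcongr
        exact (Finset.mem_Icc.1 hi).2

theorem block_subset_of_half_le {n i j : ℕ} (hj : j ∈ block seqWeight n) (hij : i ≤ j)
    (hji : j / 2 ≤ i) : i ∈ block seqWeight n ∪ block seqWeight (n - 1) := by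
  have hj_level : level (seqWeight j) = n := hj
  have hj_le := pow_level_le (one_le_seqWeight j)
  have hj_lt := lt_pow_level_succ (one_le_seqWeight j)
  rw [hj_level] at hj_le hj_lt
  have hupper : level (seqWeight i) < n + 1 := by
    rw [← not_le, le_level_iff (one_le_seqWeight i), not_le]
    exact (monotone_seqWeight hij).trans_lt hj_lt
  have hlower : n - 1 ≤ level (seqWeight i) := by
    rcases n with _ | n
    · simp
    rw [le_level_iff (one_le_seqWeight i), Nat.add_sub_cancel]
    have hlog : seqWeight j ≤ seqWeight i + Real.log 2 := by
      rw [seqWeight, seqWeight, add_assoc, ← Real.log_mul (by positivity) two_ne_zero]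
      gcongr
      exact_mod_cast (by omega : j + 1 ≤ (i + 1) * 2)
    have hone : (1 : ℝ) ≤ 2 ^ n := one_le_pow₀ one_le_two
    linarith [pow_succ (2 : ℝ) n, Real.log_two_lt_d9]
  have hlevel : level (seqWeight i) = n ∨ level (seqWeight i) = n - 1 := by omega
  exact hlevel

variable {ι : Type} (c : ι → ℂ) {q : ℝ≥0∞}

/-- The sequence `k ^ (1 / 2) c_k^*`, at `k = j + 1`. -/
def scaledRearr (j : ℕ) : ℝ≥0∞ := ((j : ℝ≥0∞) + 1) ^ (1 / 2 : ℝ) * seqRearr c j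

/-- The norm of `k ^ (1 / 2 - 1 / q) c_k^*` in `l_q` over the block of those `k` that satisfy
`2 ^ n ≤ 1 + log k < 2 ^ (n + 1)`. -/
def blockNorm (q : ℝ≥0∞) (n : ℕ) : ℝ≥0∞ :=
  eLpNorm (scaledRearr c) q (harmonicMeasure.restrict (block seqWeight n))

/-- The sum of the `l_2`-norms of `c^*` over the blocks from the `n`-th on. -/
def blockTail (n : ℕ) : ℝ≥0∞ := ∑' i, blockNorm c 2 (n + i)

theorem lzSeqNorm_two_eq (hq : q ≠ 0) (β : ℝ) :
    lzSeqNorm 2 q β c =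
      eLpNorm (fun j => ENNReal.ofReal (seqWeight j) ^ β * scaledRearr c j) q harmonicMeasure := by
  rw [← Measure.restrict_univ (μ := harmonicMeasure), eLpNorm_harmonicMeasure_restrict _ _ hq,
    Measure.restrict_univ, lzSeqNorm]
  congr with j
  have hj : (0 : ℝ) < (j : ℝ) + 1 := by positivity
  have hcast : ENNReal.ofReal ((j : ℝ) + 1) = (j : ℝ≥0∞) + 1 := by
    rw [ENNReal.ofReal_add j.cast_nonneg zero_le_one, ENNReal.ofReal_natCast, ENNReal.ofReal_one]
  rw [ENNReal.ofReal_mul (Real.rpow_nonneg hj.le _), ← ENNReal.ofReal_rpow_of_pos hj, ← seqWeight,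
    ← ENNReal.ofReal_rpow_of_pos (zero_lt_one.trans_le (one_le_seqWeight j)), hcast, recip_two,
    sub_eq_add_neg, ENNReal.rpow_add _ _ (by simp) (by simp), ENNReal.inv_rpow,
    ENNReal.rpow_neg, scaledRearr]
  ring

theorem geomNorm_blockNorm_le (hq : q ≠ 0) (β : ℝ) :
    geomNorm q β (blockNorm c q) ≤ 2 ^ |β| * lzSeqNorm 2 q β c := by
  rw [lzSeqNorm_two_eq c hq]
  exact geomNorm_le_eLpNorm_weight_mul measurable_from_top one_le_seqWeight hq _ β

theorem blockNorm_two (n : ℕ) :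
    blockNorm c 2 n = eLpNorm (seqRearr c) 2 (Measure.count.restrict (block seqWeight n)) := by
  rw [blockNorm, eLpNorm_harmonicMeasure_restrict _ _ two_ne_zero]
  congr with j
  rw [scaledRearr, recip_two, ← mul_assoc, ENNReal.inv_rpow, ENNReal.inv_mul_cancel, one_mul]
  · simp
  · exact ENNReal.rpow_ne_top_of_nonneg (by norm_num) (by simp)

theorem tailNorm_le_blockTail {K n : ℕ} (h : (2 : ℝ) ^ n ≤ seqWeight K) :
    tailNorm c K ≤ blockTail c n := by
  set S : Set ℕ := ⋃ i, block seqWeight (n + i) with hS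
  have hmem (k : ℕ) : k + K ∈ S := by
    have hn : n ≤ level (seqWeight (k + K)) :=
      (le_level_iff (one_le_seqWeight _)).2 (h.trans (monotone_seqWeight (K.le_add_left k)))
    exact mem_iUnion.2 ⟨level (seqWeight (k + K)) - n, (Nat.add_sub_cancel' hn).symm⟩
  calc tailNorm c K
      = eLpNorm (fun k => S.indicator (seqRearr c) (k + K)) 2 Measure.count := by
        simp only [tailNorm, indicator_of_mem (hmem _)]
    _ ≤ eLpNorm (S.indicator (seqRearr c)) 2 Measure.count :=
        eLpNorm_count_comp_le _ two_ne_zero (add_left_injective K)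
    _ = eLpNorm (seqRearr c) 2 (Measure.count.restrict S) :=
        eLpNorm_indicator_eq_eLpNorm_restrict .of_discrete
    _ = eLpNorm (fun i => blockNorm c 2 (n + i)) 2 Measure.count := by
        simp only [blockNorm_two]
        rw [hS, Measure.restrict_iUnion _ fun _ => .of_discrete,
          eLpNorm_sum_measure _ _ two_ne_zero]
        exact fun i j hij => Disjoint.preimage _ (by simpa using hij)
    _ ≤ eLpNorm (fun i => blockNorm c 2 (n + i)) 1 Measure.count :=
        eLpNorm_count_anti _ one_ne_zero one_le_two
    _ = blockTail c n := by simp [eLpNorm_one_eq_lintegral_enorm, lintegral_count, blockTail]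

theorem blockNorm_two_le_of_two_le (hq : 2 ≤ q) (n : ℕ) :
    blockNorm c 2 n ≤
      2 ^ (1 / 2 - recip q) * (2 ^ (n * (1 / 2 - recip q)) * blockNorm c q n) := by
  have hrecip : 0 ≤ 1 / 2 - recip q := sub_nonneg.2 (recip_two ▸ recip_anti two_ne_zero hq)
  have hexp : 1 / (2 : ℝ≥0∞).toReal - 1 / q.toReal = 1 / 2 - recip q := by
    simp [recip, ENNReal.toReal_inv]
  have hmeas : harmonicMeasure (block seqWeight n) ^ (1 / 2 - recip q) ≤
      2 ^ (1 / 2 - recip q) * 2 ^ (n * (1 / 2 - recip q)) := by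
    rw [ENNReal.rpow_mul, ENNReal.rpow_natCast, ← ENNReal.mul_rpow_of_nonneg _ _ hrecip,
      ← pow_succ']
    exact ENNReal.rpow_le_rpow (harmonicMeasure_block_le n) hrecip
  have h := eLpNorm_le_eLpNorm_mul_rpow_measure_univ hq (f := scaledRearr c)
    (μ := harmonicMeasure.restrict (block seqWeight n)) measurable_from_top.aestronglyMeasurable
  rw [hexp, Measure.restrict_apply_univ, mul_comm] at h
  exact h.trans ((mul_le_mul' hmeas le_rfl).trans_eq (mul_assoc _ _ _))

theorem scaledRearr_le_two_mul {i j : ℕ} (hij : i ≤ j) (hji : j / 2 ≤ i) :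
    scaledRearr c j ≤ 2 * scaledRearr c i := by
  have hle : (j : ℝ≥0∞) + 1 ≤ 2 ^ (2 : ℝ) * ((i : ℝ≥0∞) + 1) := by
    rw [ENNReal.rpow_two]
    exact_mod_cast (by omega : j + 1 ≤ 2 ^ 2 * (i + 1))
  rw [scaledRearr, scaledRearr, ← mul_assoc]
  gcongr
  · calc ((j : ℝ≥0∞) + 1) ^ (1 / 2 : ℝ)
        ≤ (2 ^ (2 : ℝ) * ((i : ℝ≥0∞) + 1)) ^ (1 / 2 : ℝ) := by gcongr
      _ = 2 * ((i : ℝ≥0∞) + 1) ^ (1 / 2 : ℝ) := by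
        rw [ENNReal.mul_rpow_of_nonneg _ _ (by norm_num), ← ENNReal.rpow_mul]
        norm_num
  · exact seqRearr_antitone c hij

theorem scaledRearr_le_eLpNorm (hq : 1 ≤ q) (j : ℕ) :
    scaledRearr c j ≤ 4 * eLpNorm (scaledRearr c) q
      (harmonicMeasure.restrict (Finset.Icc (j / 2) j : Finset ℕ)) := by
  have hq₀ : q ≠ 0 := (zero_lt_one.trans_le hq).ne'
  set ν := harmonicMeasure.restrict (Finset.Icc (j / 2) j : Finset ℕ) with hν
  have hmass : 2⁻¹ ≤ ν univ ^ (1 / q.toReal) := by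
    have hexp : 1 / q.toReal ≤ 1 := by
      simpa [recip, ENNReal.toReal_inv] using recip_anti one_ne_zero hq
    calc (2⁻¹ : ℝ≥0∞) ≤ 2⁻¹ ^ (1 / q.toReal) := by
          simpa using ENNReal.rpow_le_rpow_of_exponent_ge (x := 2⁻¹) (by norm_num) hexp
      _ ≤ ν univ ^ (1 / q.toReal) := by
          rw [hν, Measure.restrict_apply_univ]
          exact ENNReal.rpow_le_rpow (two_inv_le_harmonicMeasure_Icc j) (by positivity)
  have hν₀ : ν ≠ 0 := fun h => by
    have huniv : 2⁻¹ ≤ ν univ := by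
      simpa only [hν, Measure.restrict_apply_univ] using two_inv_le_harmonicMeasure_Icc j
    simp [h] at huniv
  calc scaledRearr c j = 2 * (scaledRearr c j * 2⁻¹) := by
        rw [mul_left_comm, ENNReal.mul_inv_cancel two_ne_zero ENNReal.ofNat_ne_top, mul_one]
    _ ≤ 2 * (scaledRearr c j * ν univ ^ (1 / q.toReal)) := by gcongr
    _ = 2 * eLpNorm (fun _ => scaledRearr c j) q ν := by
        rw [eLpNorm_const _ hq₀ hν₀, enorm_eq_self]
    _ ≤ 2 * eLpNorm (fun i => 2 * scaledRearr c i) q ν := by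
        gcongr 2 * ?_
        refine eLpNorm_mono_enorm_ae ?_
        filter_upwards [ae_restrict_mem .of_discrete] with i hi
        rw [Finset.mem_coe, Finset.mem_Icc] at hi
        exact scaledRearr_le_two_mul c hi.2 hi.1
    _ = 4 * eLpNorm (scaledRearr c) q ν := by
        rw [eLpNorm_ennreal_const_mul _ ENNReal.ofNat_ne_top, ← mul_assoc]
        norm_num

theorem blockNorm_two_le_of_le_two (hq : 1 ≤ q) (hq_two : q ≤ 2) (n : ℕ) :
    blockNorm c 2 n ≤ 4 * (blockNorm c q n + blockNorm c q (n - 1)) := by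
  have hq₀ : q ≠ 0 := (zero_lt_one.trans_le hq).ne'
  refine eLpNorm_le_of_exponent_le_of_bound hq₀ hq_two ?_
    (le_self_add.trans (le_mul_of_one_le_left' (by norm_num)))
  filter_upwards [ae_restrict_mem .of_discrete] with j hj
  refine (scaledRearr_le_eLpNorm c hq j).trans ?_
  gcongr
  refine (eLpNorm_mono_measure _ (Measure.restrict_mono (fun i hi => ?_) le_rfl)).trans
    (eLpNorm_restrict_union_le measurable_from_top.aestronglyMeasurable .of_discrete
      .of_discrete hq)
  rw [Finset.mem_coe, Finset.mem_Icc] at hi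
  exact block_subset_of_half_le hj hi.2 hi.1

theorem geomNorm_blockNorm_two_le_of_two_le (hq : 2 ≤ q) (α : ℝ) :
    geomNorm q (α + recip q) (blockNorm c 2) ≤
      2 ^ (1 / 2 - recip q) * 2 ^ |α + 1 / 2| * lzSeqNorm 2 q (α + 1 / 2) c := by
  have hq₀ : q ≠ 0 := (zero_lt_two.trans_le hq).ne'
  refine (geomNorm_mono (blockNorm_two_le_of_two_le c hq)).trans ?_
  rw [geomNorm_const_mul (two_rpow_ne_top _), geomNorm_two_rpow_mul, mul_assoc,
    show α + recip q + (1 / 2 - recip q) = α + 1 / 2 by ring]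
  exact mul_le_mul' le_rfl (geomNorm_blockNorm_le c hq₀ _)

theorem geomNorm_blockNorm_two_le_of_le_two (hq : 1 ≤ q) (hq_two : q ≤ 2) (γ : ℝ) :
    geomNorm q γ (blockNorm c 2) ≤ 4 * (2 + 2 ^ γ) * 2 ^ |γ| * lzSeqNorm 2 q γ c := by
  have hq₀ : q ≠ 0 := (zero_lt_one.trans_le hq).ne'
  have hshift : geomNorm q γ (fun n => blockNorm c q (n - 1)) ≤
      geomNorm q γ (blockNorm c q) + 2 ^ γ * geomNorm q γ (blockNorm c q) := by
    refine (geomNorm_le_sum_add_shift hq 1).trans (add_le_add ?_ ?_)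
    · simpa using apply_zero_le_geomNorm hq₀
    · simp
  calc geomNorm q γ (blockNorm c 2)
      ≤ geomNorm q γ (fun n => 4 * (blockNorm c q n + blockNorm c q (n - 1))) :=
        geomNorm_mono (blockNorm_two_le_of_le_two c hq hq_two)
    _ ≤ 4 * (geomNorm q γ (blockNorm c q) +
          (geomNorm q γ (blockNorm c q) + 2 ^ γ * geomNorm q γ (blockNorm c q))) := by
        rw [geomNorm_const_mul ENNReal.ofNat_ne_top]
        gcongr
        exact (geomNorm_add_le hq).trans (add_le_add le_rfl hshift)
    _ = 4 * (2 + 2 ^ γ) * geomNorm q γ (blockNorm c q) := by ring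
    _ ≤ 4 * (2 + 2 ^ γ) * 2 ^ |γ| * lzSeqNorm 2 q γ c := by
        rw [mul_assoc _ (2 ^ |γ|)]
        exact mul_le_mul' le_rfl (geomNorm_blockNorm_le c hq₀ γ)

theorem exists_geomNorm_blockTail_le (hq : 1 ≤ q) {α : ℝ} (hα : 0 < α + recip q) : ∃ C : ℝ≥0,
    ∀ {ι : Type} (c : ι → ℂ),
      geomNorm q (α + recip q) (blockTail c) ≤ C * lzSeqNorm 2 q (α + recip (min q 2)) c := by
  obtain ⟨B, hB_top, hB⟩ : ∃ B : ℝ≥0∞, B ≠ ∞ ∧ ∀ {ι : Type} (c : ι → ℂ),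
      geomNorm q (α + recip q) (blockNorm c 2) ≤
        B * lzSeqNorm 2 q (α + recip (min q 2)) c := by
    rcases le_total q 2 with h | h
    · rw [min_eq_left h]
      refine ⟨_, ?_, fun c => geomNorm_blockNorm_two_le_of_le_two c hq h _⟩
      finiteness [two_rpow_ne_top (α + recip q), two_rpow_ne_top |α + recip q|]
    · rw [min_eq_right h, recip_two]
      exact ⟨_, ENNReal.mul_ne_top (two_rpow_ne_top _) (two_rpow_ne_top _),
        fun c => geomNorm_blockNorm_two_le_of_two_le c h α⟩
  lift B to ℝ≥0 using hB_top
  have hHardy {ι : Type} (c : ι → ℂ) :=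
    geomNorm_tsum_shift_le (γ := α + recip q) (y := blockNorm c 2) hq
  lift (1 - (2 : ℝ≥0∞) ^ (-(α + recip q)))⁻¹ to ℝ≥0 using
    inv_one_sub_two_rpow_neg_ne_top hα with A
  refine ⟨A * B, fun c => (hHardy c).trans ?_⟩
  rw [ENNReal.coe_mul, mul_assoc]
  exact mul_le_mul' le_rfl (hB c)

end SequenceBlocks

section EndpointEstimate

theorem geomNorm_le_of_shift_le {q : ℝ≥0∞} (hq : 1 ≤ q) {γ : ℝ} {y z : ℕ → ℝ≥0∞} {a : ℝ≥0∞}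
    {k l : ℕ} (hy : ∀ n, y n ≤ a) (hyz : ∀ n, k ≤ n → y (n + l) ≤ z n) :
    geomNorm q γ y ≤ 2 ^ (-γ) * (1 - (2 : ℝ≥0∞) ^ (-γ))⁻¹ * 2 ^ (l * γ) * 2 ^ (k * γ) * a +
      2 ^ (l * γ) * geomNorm q γ z := by
  have hsplit : (2 : ℝ≥0∞) ^ ((k + l : ℕ) * γ) = 2 ^ (l * γ) * 2 ^ (k * γ) := by
    rw [Nat.cast_add, add_mul, two_rpow_add, mul_comm]
  refine (geomNorm_le_sum_add_shift hq (k + l)).trans (add_le_add ?_ ?_)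
  · calc ∑ m ∈ Finset.range (k + l), (2 : ℝ≥0∞) ^ (m * γ) * y m
        ≤ (∑ m ∈ Finset.range (k + l), (2 : ℝ≥0∞) ^ (m * γ)) * a := by
          rw [Finset.sum_mul]
          gcongr with m
          exact hy m
      _ ≤ 2 ^ (-γ) * (1 - (2 : ℝ≥0∞) ^ (-γ))⁻¹ * 2 ^ ((k + l : ℕ) * γ) * a := by
          gcongr
          exact sum_range_two_rpow_le γ (k + l)
      _ = _ := by rw [hsplit, mul_assoc _ (2 ^ (l * γ))]
  · rw [hsplit, mul_assoc]
    gcongr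
    calc (2 : ℝ≥0∞) ^ (k * γ) * geomNorm q γ (fun n => y (n + (k + l)))
        ≤ 2 ^ (k * γ) * geomNorm q γ (fun n => z (n + k)) := by
          gcongr
          refine geomNorm_mono fun n => ?_
          rw [← add_assoc]
          exact hyz _ le_add_self
      _ ≤ geomNorm q γ z := two_rpow_mul_geomNorm_shift_le (zero_lt_one.trans_le hq).ne' k

/-- The decay of the bounded part of the series over the blocks with `2 ^ n ≥ 1 + log M`. -/
def expDecay (n : ℕ) : ℝ≥0∞ := ENNReal.ofReal (Real.exp (-(1 / 2) * 2 ^ n))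

theorem geomNorm_expDecay_ne_top {q : ℝ≥0∞} (hq : 1 ≤ q) (γ : ℝ) : geomNorm q γ expDecay ≠ ∞ := by
  obtain ⟨C, hC⟩ := ((tendsto_rpow_mul_exp_neg_mul_atTop_nhds_zero (γ + 1) (1 / 2)
    (by norm_num)).comp (tendsto_pow_atTop_atTop_of_one_lt one_lt_two)).bddAbove_range
  have hterm (n : ℕ) : (2 : ℝ≥0∞) ^ (n * γ) * expDecay n ≤ ENNReal.ofReal C * 2⁻¹ ^ n := by
    have hreal : ((2 : ℝ) ^ n) ^ γ * Real.exp (-(1 / 2) * 2 ^ n) ≤ C * (2 ^ n)⁻¹ := by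
      rw [← div_eq_mul_inv, le_div_iff₀ (by positivity), mul_right_comm,
        ← Real.rpow_add_one (by positivity)]
      exact hC ⟨n, rfl⟩
    calc (2 : ℝ≥0∞) ^ (n * γ) * expDecay n
        = ENNReal.ofReal (((2 : ℝ) ^ n) ^ γ * Real.exp (-(1 / 2) * 2 ^ n)) := by
          rw [ENNReal.ofReal_mul (by positivity), ← ENNReal.ofReal_rpow_of_pos (by positivity),
            ofReal_two_pow, ENNReal.rpow_mul, ENNReal.rpow_natCast, expDecay]
      _ ≤ ENNReal.ofReal (C * (2 ^ n)⁻¹) := ENNReal.ofReal_le_ofReal hreal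
      _ = ENNReal.ofReal C * 2⁻¹ ^ n := by
          rw [ENNReal.ofReal_mul' (by positivity), ENNReal.ofReal_inv_of_pos (by positivity),
            ofReal_two_pow, ENNReal.inv_pow]
  refine ne_top_of_le_ne_top (ENNReal.mul_ne_top ENNReal.ofReal_ne_top ?_)
    ((geomNorm_anti one_ne_zero hq).trans ?_) (b := ENNReal.ofReal C * ∑' n, 2⁻¹ ^ n)
  · simp
  · rw [geomNorm_one_eq_tsum, ← ENNReal.tsum_mul_left]
    exact ENNReal.tsum_le_tsum hterm

/-- The number `K` for which the `2 K` largest coefficients form the bounded part of the series in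
the estimate at `blockTime (n + 2)`. -/
def cutoff (n : ℕ) : ℕ := ⌈Real.exp (2 ^ n - 1)⌉₊

theorem two_pow_le_seqWeight_cutoff (n : ℕ) : (2 : ℝ) ^ n ≤ seqWeight (cutoff n) := by
  have hlog : (2 : ℝ) ^ n - 1 ≤ Real.log (cutoff n + 1) := by
    rw [Real.le_log_iff_exp_le (by positivity)]
    exact (Nat.le_ceil _).trans (le_add_of_nonneg_right zero_le_one)
  rw [seqWeight]
  linarith

theorem two_mul_cutoff_le (n : ℕ) : ((2 * cutoff n : ℕ) : ℝ) ≤ 4 * Real.exp (2 ^ n - 1) := by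
  have hceil := Nat.ceil_lt_add_one (Real.exp_pos (2 ^ n - 1)).le
  have hone : 1 ≤ Real.exp ((2 : ℝ) ^ n - 1) :=
    Real.one_le_exp (sub_nonneg.2 (one_le_pow₀ one_le_two))
  push_cast [cutoff]
  linarith

theorem mul_sqrt_cutoff_mul_sqrt_blockTime_le {M : ℝ≥0} {n : ℕ} (hn : 1 + Real.log M ≤ 2 ^ n) :
    (M : ℝ≥0∞) * ((2 * cutoff n : ℕ) : ℝ≥0∞) ^ (1 / 2 : ℝ) *
      ENNReal.ofReal (blockTime (n + 2)) ^ (1 / 2 : ℝ) ≤ 2 * expDecay n := by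
  set x : ℝ := 2 ^ n with hx
  have hM : (M : ℝ) ≤ Real.exp (x - 1) :=
    (Real.le_exp_log M).trans (Real.exp_le_exp.2 (by linarith))
  have htime : blockTime (n + 2) = Real.exp (1 - 4 * x) := by
    rw [blockTime, pow_add, ← hx]
    ring_nf
  have hreal : M * √(2 * cutoff n : ℕ) * √(blockTime (n + 2)) ≤
      2 * Real.exp (-(1 / 2) * x) :=
    calc M * √(2 * cutoff n : ℕ) * √(blockTime (n + 2))
        ≤ Real.exp (x - 1) * √(4 * Real.exp (x - 1)) * √(Real.exp (1 - 4 * x)) := by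
          rw [htime]
          gcongr
          exact two_mul_cutoff_le n
      _ = 2 * Real.exp ((x - 1) + (x - 1) / 2 + (1 - 4 * x) / 2) := by
          rw [Real.sqrt_mul zero_le_four, show (4 : ℝ) = 2 ^ 2 by norm_num,
            Real.sqrt_sq zero_le_two, ← Real.exp_half, ← Real.exp_half, Real.exp_add,
            Real.exp_add]
          ring
      _ ≤ 2 * Real.exp (-(1 / 2) * x) := by
          gcongr
          linarith
  have hsqrt {r : ℝ} (hr : 0 ≤ r) : ENNReal.ofReal r ^ (1 / 2 : ℝ) = ENNReal.ofReal √r := by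
    rw [ENNReal.ofReal_rpow_of_nonneg hr (by norm_num), Real.sqrt_eq_rpow]
  rw [← ENNReal.ofReal_natCast, hsqrt (Nat.cast_nonneg _), hsqrt (blockTime_pos _).le,
    ← ENNReal.ofReal_coe_nnreal, ← ENNReal.ofReal_mul M.coe_nonneg,
    ← ENNReal.ofReal_mul (by positivity), expDecay, ← ENNReal.ofReal_ofNat 2,
    ← ENNReal.ofReal_mul zero_le_two]
  exact ENNReal.ofReal_le_ofReal hreal

variable {ι : Type} {φ : ι → Lp ℂ 2 μ01} {M : ℝ≥0} {c : ι → ℂ} {f : Lp ℂ 2 μ01}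

theorem tailNorm_zero_le_blockTail_zero (c : ι → ℂ) : tailNorm c 0 ≤ blockTail c 0 :=
  tailNorm_le_blockTail c (by simpa using one_le_seqWeight 0)

theorem partialL2_blockTime_le (hφ : Orthonormal ℂ φ) (hM : ∀ n, eLpNorm (φ n) ∞ μ01 ≤ M)
    (hf : HasSum (fun n => c n • φ n) f) {n : ℕ} (hn : 1 + Real.log M ≤ 2 ^ n) :
    partialL2 f (blockTime (n + 2)) ≤ 2 * (blockTail c 0 * expDecay n + blockTail c n) :=
  calc partialL2 f (blockTime (n + 2))
      ≤ M * ((2 * cutoff n : ℕ) : ℝ≥0∞) ^ (1 / 2 : ℝ) * tailNorm c 0 *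
          ENNReal.ofReal (blockTime (n + 2)) ^ (1 / 2 : ℝ) + 2 * tailNorm c (cutoff n) :=
        partialL2_le_of_hasSum hφ hM hf _ _
    _ = M * ((2 * cutoff n : ℕ) : ℝ≥0∞) ^ (1 / 2 : ℝ) *
          ENNReal.ofReal (blockTime (n + 2)) ^ (1 / 2 : ℝ) * tailNorm c 0 +
          2 * tailNorm c (cutoff n) := by ring
    _ ≤ 2 * expDecay n * blockTail c 0 + 2 * blockTail c n := by
        grw [mul_sqrt_cutoff_mul_sqrt_blockTime_le hn, tailNorm_zero_le_blockTail_zero,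
          tailNorm_le_blockTail c (two_pow_le_seqWeight_cutoff n)]
    _ = 2 * (blockTail c 0 * expDecay n + blockTail c n) := by ring

theorem geomNorm_partialL2_le (hφ : Orthonormal ℂ φ) (hM : ∀ n, eLpNorm (φ n) ∞ μ01 ≤ M)
    (hf : HasSum (fun n => c n • φ n) f) (hc : blockTail c 0 ≠ ∞) {q : ℝ≥0∞} (hq : 1 ≤ q) (γ : ℝ)
    {k : ℕ} (hk : 1 + Real.log M ≤ 2 ^ k) :
    geomNorm q γ (fun m => partialL2 f (blockTime m)) ≤
      2 * 2 ^ (2 * γ) * (2 ^ (-γ) * (1 - (2 : ℝ≥0∞) ^ (-γ))⁻¹ * 2 ^ (k * γ) +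
        (geomNorm q γ expDecay + 1)) * geomNorm q γ (blockTail c) := by
  set T := geomNorm q γ (blockTail c)
  have hzero : blockTail c 0 ≤ T := apply_zero_le_geomNorm (zero_lt_one.trans_le hq).ne'
  have hbound (m : ℕ) : partialL2 f (blockTime m) ≤ 2 * T :=
    (partialL2_le_tailNorm_zero hφ hf _).trans
      (mul_le_mul' le_rfl ((tailNorm_zero_le_blockTail_zero c).trans hzero))
  have hendpoint (n : ℕ) (hn : k ≤ n) :=
    partialL2_blockTime_le hφ hM hf (hk.trans (pow_le_pow_right₀ one_le_two hn))
  have htail : geomNorm q γ (fun n => 2 * (blockTail c 0 * expDecay n + blockTail c n)) ≤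
      2 * (T * geomNorm q γ expDecay + T) := by
    rw [geomNorm_const_mul ENNReal.ofNat_ne_top]
    gcongr
    refine (geomNorm_add_le hq).trans ?_
    rw [geomNorm_const_mul hc]
    gcongr
  refine (geomNorm_le_of_shift_le hq hbound hendpoint).trans ?_
  grw [htail, Nat.cast_two]
  exact le_of_eq (by ring)

theorem exists_geomNorm_partialL2_le {q : ℝ≥0∞} (hq : 1 ≤ q) {γ : ℝ} (hγ : 0 < γ) :
    ∃ C : ℝ≥0, ∀ {ι : Type} {φ : ι → Lp ℂ 2 μ01} {M : ℝ≥0} {c : ι → ℂ} {f : Lp ℂ 2 μ01},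
      1 ≤ M → Orthonormal ℂ φ → (∀ n, eLpNorm (φ n) ∞ μ01 ≤ M) →
      HasSum (fun n => c n • φ n) f → blockTail c 0 ≠ ∞ →
      geomNorm q γ (fun m => partialL2 f (blockTime m)) ≤
        C * ENNReal.ofReal ((1 + Real.log M) ^ γ) * geomNorm q γ (blockTail c) := by
  set A : ℝ≥0∞ := 2 ^ (-γ) * (1 - (2 : ℝ≥0∞) ^ (-γ))⁻¹
  set D : ℝ≥0∞ := geomNorm q γ expDecay + 1
  have hC_top : 2 * 2 ^ (2 * γ) * (A * (2 ^ γ * 2 ^ |γ|) + D) ≠ ∞ := by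
    finiteness [two_rpow_ne_top (-γ), two_rpow_ne_top (2 * γ), two_rpow_ne_top γ,
      two_rpow_ne_top |γ|, inv_one_sub_two_rpow_neg_ne_top hγ, geomNorm_expDecay_ne_top hq γ]
  refine ⟨(2 * 2 ^ (2 * γ) * (A * (2 ^ γ * 2 ^ |γ|) + D)).toNNReal,
    fun {ι φ M c f} hM_one hφ hM hf hc => ?_⟩
  have hlog : 1 ≤ 1 + Real.log M := le_add_of_nonneg_right (Real.log_nonneg hM_one)
  set L : ℝ≥0∞ := ENNReal.ofReal ((1 + Real.log M) ^ γ) with hL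
  have hL_one : 1 ≤ L := ENNReal.one_le_ofReal.2 (Real.one_le_rpow hlog hγ.le)
  have hpow : (2 : ℝ≥0∞) ^ ((level (1 + Real.log M) + 1 : ℕ) * γ) ≤ 2 ^ γ * 2 ^ |γ| * L := by
    rw [Nat.cast_succ, add_one_mul, add_comm, two_rpow_add, mul_assoc, hL,
      ← ENNReal.ofReal_rpow_of_pos (zero_lt_one.trans_le hlog)]
    gcongr
    exact two_rpow_level_le_ofReal_rpow hlog γ
  rw [ENNReal.coe_toNNReal hC_top]
  calc geomNorm q γ (fun m => partialL2 f (blockTime m))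
      ≤ 2 * 2 ^ (2 * γ) * (A * 2 ^ ((level (1 + Real.log M) + 1 : ℕ) * γ) + D) *
          geomNorm q γ (blockTail c) :=
        geomNorm_partialL2_le hφ hM hf hc hq γ (lt_pow_level_succ hlog).le
    _ ≤ 2 * 2 ^ (2 * γ) * (A * (2 ^ γ * 2 ^ |γ| * L) + D * L) * geomNorm q γ (blockTail c) := by
        gcongr
        exact le_mul_of_one_le_right' hL_one
    _ = 2 * 2 ^ (2 * γ) * (A * (2 ^ γ * 2 ^ |γ|) + D) * L * geomNorm q γ (blockTail c) := by ring

theorem one_le_of_orthonormal [Nonempty ι] (hφ : Orthonormal ℂ φ)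
    (hM : ∀ n, eLpNorm (φ n) ∞ μ01 ≤ M) : 1 ≤ M := by
  obtain ⟨n⟩ := ‹Nonempty ι›
  have : IsProbabilityMeasure μ01 := ⟨by simp [μ01]⟩
  have hnorm : ‖φ n‖ₑ = 1 := by rw [← ofReal_norm, hφ.1 n, ENNReal.ofReal_one]
  rw [← ENNReal.coe_le_coe, ENNReal.coe_one, ← hnorm, Lp.enorm_def]
  exact (eLpNorm_le_eLpNorm_of_exponent_le le_top (Lp.aestronglyMeasurable _)).trans (hM n)

theorem ofReal_one_add_log_rpow_le (hM : 1 ≤ M) {a b : ℝ} (hab : a ≤ b) :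
    ENNReal.ofReal ((1 + Real.log M) ^ a) ≤ ENNReal.ofReal ((1 + Real.log M) ^ b) :=
  ENNReal.ofReal_le_ofReal (Real.rpow_le_rpow_of_exponent_le
    (le_add_of_nonneg_right (Real.log_nonneg hM)) hab)

end EndpointEstimate

end LorentzZygmund

end

open LorentzZygmund in
theorem corollary4p4_general {q : ℝ≥0∞} (hq : 1 ≤ q) {α : ℝ} (hα : -recip q < α) :
    ∃ C : ℝ≥0, ∀ (ι : Type) [Nonempty ι] (φ : ι → Lp ℂ 2 μ01) (M : ℝ≥0),
      Orthonormal ℂ φ → (∀ n, eLpNorm (φ n) ∞ μ01 ≤ M) →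
      ∀ c : ι → ℂ, lzSeqNorm 2 q (α + recip (min q 2)) c < ∞ →
        ∃ f : Lp ℂ 2 μ01,
          HasSum (fun n => c n • φ n) f ∧
          max (limNorm 2 q α 2 f)
              (max (lzNorm 2 q (α + recip (max q 2)) f) (lzNorm 2 (max q 2) (α + recip q) f)) ≤
            C * ENNReal.ofReal ((1 + Real.log M) ^ (α + recip q)) *
              lzSeqNorm 2 q (α + recip (min q 2)) c := by
  have hq₀ : q ≠ 0 := (zero_lt_one.trans_le hq).ne'
  have hγ : 0 < α + recip q := neg_lt_iff_pos_add.1 hα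
  obtain ⟨A, hA⟩ := exists_max_norm_le_geomNorm hq₀ α
  obtain ⟨B, hB⟩ := exists_geomNorm_partialL2_le hq hγ
  obtain ⟨D, hD⟩ := exists_geomNorm_blockTail_le hq hγ
  refine ⟨A * B * D, fun ι _ φ M hφ hM c hc => ?_⟩
  have htail : blockTail c 0 ≠ ∞ :=
    ne_top_of_le_ne_top (ENNReal.mul_ne_top ENNReal.coe_ne_top hc.ne)
      ((apply_zero_le_geomNorm hq₀).trans (hD c))
  have hsq : ∑' n, ‖c n‖ₑ ^ 2 ≠ ∞ := by
    refine ne_top_of_le_ne_top (ENNReal.pow_ne_top htail (n := 2)) ?_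
    grw [tsum_enorm_sq_le_tailNorm_sq, tailNorm_zero_le_blockTail_zero]
  obtain ⟨f, hf⟩ := summable_smul_of_orthonormal hφ hsq
  refine ⟨f, hf, (hA f).trans ?_⟩
  grw [hB (one_le_of_orthonormal hφ hM) hφ hM hf htail, hD c]
  push_cast
  exact le_of_eq (by ring)

open LorentzZygmund in
theorem corollary4p4 (q : ℝ≥0∞) (hq : 1 < q) (α : ℝ)
    (hα_lower : max (-recip q) (recip q - 1) < α) (hα_upper : α < 1 - recip q) :
    ∃ ε₀ : ℝ, 0 < ε₀ ∧ ∀ ε : ℝ, 0 < ε → ε < ε₀ →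
      ∃ C : ℝ≥0, ∀ (ι : Type) [Countable ι] [Infinite ι] (φ : ι → Lp ℂ 2 μ01) (M : ℝ≥0),
        Orthonormal ℂ φ →
        (⨆ n, eLpNorm (φ n) ∞ μ01) = (M : ℝ≥0∞) →
        ∀ c : ι → ℂ, lzSeqNorm 2 q (α + recip (min q 2)) c < ∞ →
          ∃ f : Lp ℂ 2 μ01,
            HasSum (fun n => c n • φ n) f ∧
            limNorm 2 q α 2 f ≤
              C * ENNReal.ofReal ((1 + Real.log M) ^ |α + ε + recip q|) *
                lzSeqNorm 2 q (α + recip (min q 2)) c ∧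
            max (lzNorm 2 q (α + recip (max q 2)) f) (lzNorm 2 (max q 2) (α + recip q) f) ≤
              C * ENNReal.ofReal ((1 + Real.log M) ^ |α + ε + recip q|) *
                lzSeqNorm 2 q (α + recip (min q 2)) c := by
  refine ⟨1, one_pos, fun ε hε _ => ?_⟩
  obtain ⟨C, hC⟩ := corollary4p4_general hq.le ((le_max_left _ _).trans_lt hα_lower)
  refine ⟨C, fun ι _ _ φ M hφ hM c hc => ?_⟩
  have hM_le (n : ι) : eLpNorm (φ n) ∞ μ01 ≤ M := hM ▸ le_iSup (fun n => eLpNorm (φ n) ∞ μ01) n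
  obtain ⟨f, hf, hnorm⟩ := hC ι φ M hφ hM_le c hc
  grw [ofReal_one_add_log_rpow_le (one_le_of_orthonormal hφ hM_le)
    (show α + recip q ≤ |α + ε + recip q| from le_trans (by linarith) (le_abs_self _))] at hnorm
  exact ⟨f, hf, max_le_iff.1 hnorm⟩
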